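/- **Proposition 5.2.** Let $G$ be a compact Lie group whose Lie algebra $\mathfrak g$ is semisimple of type $F_4$: $\mathfrak g$ has a subalgebra $\mathfrak t$ whose complexification is a Cartan subalgebra of $\mathfrak g\otimes\mathbb C$, and the corresponding root system has a fundamental system $\{\alpha_1,\alpha_2,\alpha_3,\alpha_4\}$ with the Dynkin diagram of $F_4$, numbered along the diagram so that $\alpha_1,\alpha_2$ are long and $\alpha_3,\alpha_4$ are short. Let $\phi=2\alpha_1+3\alpha_2+4\alpha_3+2\alpha_4$ be the highest root. Let $\theta=e^{\mathrm{ad}\,T}$ and $\tau=e^{\mathrm{ad}\,T'}$, where $T,T'\in\mathfrak t$ satisfy $$\alpha_4(T)=\pi\sqrt{-1},\quad \alpha_1(T)=\alpha_2(T)=\alpha_3(T)=0;\qquad \alpha_3(T')=\pi\sqrt{-1},\quad \alpha_1(T')=\alpha_2(T')=\phi(T')=0.$$ Put $$\mathfrak h_1=\{x\in\mathfrak g\mid\theta x=x,\ \tau x=x\},\quad \mathfrak h_2=\{x\in\mathfrak g\mid\theta x=x,\ \tau x=-x\},$$ $$\mathfrak h_3=\{x\in\mathfrak g\mid\theta x=-x,\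 \tau x=x\},\quad \mathfrak h_4=\{x\in\mathfrak g\mid\theta x=-x,\ \tau x=-x\}.$$ Let $B$ be an associative inner product on $\mathfrak g$, i.e. a positive definite symmetric bilinear form with $B([x,y],z)=B(x,[y,z])$. Then $\mathfrak g=\mathfrak h_1\oplus\mathfrak h_2\oplus\mathfrak h_3\oplus\mathfrak h_4$, and the following hold. 1. Let $H_1$ be a subgroup of $G$ with Lie algebra $\mathfrak h_1$. Every left-invariant Riemannian metric on $G$ that is $\mathrm{Ad}(H_1)$-invariant is of the form $$\langle\ ,\ \rangle=u_1B|_{\mathfrak h_1}+u_2B|_{\mathfrak h_2}+u_3B|_{\mathfrak h_3}+u_4B|_{\mathfrak h_4},\qquad u_1,u_2,u_3,u_4>0.\tag{$*$}$$ 2. For $u_1,u_2,u_3,u_4>0$, the left-invariant metric $(*)$ is Einstein if and only if $$\begin{aligned} -\frac{3}{u_1}-\frac{u_1}{2u_2^2}-\frac{u_1}{2u_3^2}-\frac{u_1}{2u_4^2} &=\frac{7u_1}{2u_2^2}-\frac{9}{u_2}+\frac{u_3^2+u_4^2-u_2^2}{u_2u_3u_4}\\ &=\frac{7u_1}{2u_3^2}-\frac{9}{u_3}+\frac{u_2^2+u_4^2-u_3^2}{u_2u_3u_4}\\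 &=\frac{7u_1}{2u_4^2}-\frac{9}{u_4}+\frac{u_2^2+u_3^2-u_4^2}{u_2u_3u_4}. \end{aligned}$$ -/

import Mathlib

open scoped Manifold TensorProduct

noncomputable section

/-! ### Real Lie algebras, their complexification, and the type `F₄` -/

namespace EinsteinF4

section LieAlgebraPart

variable {𝔤 : Type*} [LieRing 𝔤] [LieAlgebra ℝ 𝔤]

/-- The complexification `ℂ ⊗ 𝔰 ⊆ ℂ ⊗ 𝔤` of a real Lie subalgebra `𝔰 ⊆ 𝔤`. -/
def complexify (s : LieSubalgebra ℝ 𝔤) : LieSubalgebra ℂ (ℂ ⊗[ℝ] 𝔤) :=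
  { s.toSubmodule.baseChange ℂ with
    lie_mem' := by
      intro x y hx hy
      simp only [AddSubsemigroup.mem_carrier, AddSubmonoid.mem_toSubsemigroup,
        Submodule.mem_toAddSubmonoid] at hx hy ⊢
      rw [Submodule.baseChange_eq_span] at hx hy
      refine Submodule.span_induction₂
        (p := fun x y _ _ => ⁅x, y⁆ ∈ s.toSubmodule.baseChange ℂ)
        ?_ ?_ ?_ ?_ ?_ ?_ ?_ hx hy
      · rintro - - ⟨x, hx, rfl⟩ ⟨y, hy, rfl⟩
        simpa using Submodule.tmul_mem_baseChange_of_mem (p := s.toSubmodule) (1 : ℂ)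
          (s.lie_mem hx hy)
      · intro y _
        rw [zero_lie]
        exact zero_mem _
      · intro x _
        rw [show ⁅x, (0 : ℂ ⊗[ℝ] 𝔤)⁆ = 0 from (LieAlgebra.ad ℂ (ℂ ⊗[ℝ] 𝔤) x).map_zero]
        exact zero_mem _
      · intro x y z _ _ _ h1 h2
        rw [add_lie]
        exact add_mem h1 h2
      · intro x y z _ _ _ h1 h2
        rw [LieRing.lie_add]
        exact add_mem h1 h2
      · intro c x y _ _ h1
        rw [smul_lie]
        exact Submodule.smul_mem _ c h1
      · intro c x y _ _ h1
        rw [LieAlgebra.lie_smul]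
        exact Submodule.smul_mem _ c h1 }

lemma one_tmul_mem_complexify {s : LieSubalgebra ℝ 𝔤} {x : 𝔤} (hx : x ∈ s) :
    (1 : ℂ) ⊗ₜ[ℝ] x ∈ complexify s :=
  Submodule.tmul_mem_baseChange_of_mem (p := s.toSubmodule) (1 : ℂ) hx

/-- The complexification of a real Lie algebra with nondegenerate Killing form has
nondegenerate Killing form. -/
instance isKilling_complexification [Module.Finite ℝ 𝔤] [LieAlgebra.IsKilling ℝ 𝔤] :
    LieAlgebra.IsKilling ℂ (ℂ ⊗[ℝ] 𝔤) where
  killingCompl_top_eq_bot := by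
    have hK : killingForm ℂ (ℂ ⊗[ℝ] 𝔤) = (killingForm ℝ 𝔤).baseChange ℂ :=
      LieModule.traceForm_baseChange ℝ 𝔤 𝔤 ℂ
    let b := Module.finBasis ℝ 𝔤
    have h1 : (killingForm ℝ 𝔤).Nondegenerate := LieAlgebra.IsKilling.killingForm_nondegenerate _ _
    have h2 : (killingForm ℂ (ℂ ⊗[ℝ] 𝔤)).Nondegenerate := by
      rw [LinearMap.BilinForm.nondegenerate_iff_det_ne_zero (b.baseChange ℂ)]
      rw [LinearMap.BilinForm.nondegenerate_iff_det_ne_zero b] at h1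
      have : LinearMap.BilinForm.toMatrix (b.baseChange ℂ) (killingForm ℂ (ℂ ⊗[ℝ] 𝔤))
          = (LinearMap.BilinForm.toMatrix b (killingForm ℝ 𝔤)).map (algebraMap ℝ ℂ) := by
        ext i j
        simp only [LinearMap.BilinForm.toMatrix_apply, hK, Matrix.map_apply,
          Module.Basis.baseChange_apply, LinearMap.BilinForm.baseChange_tmul]
        simp
      rw [this, ← RingHom.mapMatrix_apply, ← RingHom.map_det]
      simpa using h1
    rw [LieSubmodule.eq_bot_iff]
    intro x hx
    rw [LieIdeal.mem_killingCompl] at hx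
    exact h2.2 x fun y => hx y trivial

/-- A fundamental system of type `F₄` of the real Lie algebra `𝔤`: a subalgebra `t` of `𝔤` whose
complexification is a Cartan subalgebra of `ℂ ⊗ 𝔤`, and simple roots `α₁, α₂, α₃, α₄` of the
corresponding root system whose Cartan matrix `(⟨αᵢ, αⱼ^∨⟩)` is the one of the Dynkin diagram
`α₁ — α₂ ⇒ α₃ — α₄` (so `α₁, α₂` are long and `α₃, α₄` are short).

The simple roots `α₁, …, α₄` are indexed by `0, …, 3 : Fin 4`. -/
structure FundamentalSystemF4 (𝔤 : Type*) [LieRing 𝔤] [LieAlgebra ℝ 𝔤] [Module.Finite ℝ 𝔤]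
    [LieAlgebra.IsKilling ℝ 𝔤] where
  /-- the real subalgebra `t` of `𝔤` -/
  t : LieSubalgebra ℝ 𝔤
  [isCartan : (complexify t).IsCartanSubalgebra]
  /-- the set of simple roots -/
  base : (LieAlgebra.IsKilling.rootSystem (complexify t)).Base
  /-- the numbering of the simple roots -/
  idx : Fin 4 ≃ base.support
  cartanMatrix_eq : ∀ i j, base.cartanMatrix (idx i) (idx j) = CartanMatrix.F₄ i j

attribute [instance] FundamentalSystemF4.isCartan

/-- The value `αᵢ(x)` of a simple root at `x ∈ t` (extended complex linearly, so that it is an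
imaginary number when `𝔤` is compact). -/
def FundamentalSystemF4.simpleRoot [Module.Finite ℝ 𝔤] [LieAlgebra.IsKilling ℝ 𝔤]
    (S : FundamentalSystemF4 𝔤) (i : Fin 4) (x : S.t) : ℂ :=
  (LieAlgebra.IsKilling.rootSystem (complexify S.t)).root (S.idx i)
    ⟨(1 : ℂ) ⊗ₜ[ℝ] (x : 𝔤), one_tmul_mem_complexify x.2⟩

/-- `e^{ad x} : 𝔤 → 𝔤`, the exponential of the endomorphism `ad x` of the finite-dimensional real
vector space `𝔤` (computed in a basis, on which it does not depend). -/
def expAd [Module.Finite ℝ 𝔤] (x : 𝔤) : Module.End ℝ 𝔤 :=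
  Matrix.toLin (Module.finBasis ℝ 𝔤) (Module.finBasis ℝ 𝔤)
    (NormedSpace.exp
      (LinearMap.toMatrix (Module.finBasis ℝ 𝔤) (Module.finBasis ℝ 𝔤) (LieAlgebra.ad ℝ 𝔤 x)))

/-- The joint eigenspaces `𝔥₁, 𝔥₂, 𝔥₃, 𝔥₄` (indexed by `0, …, 3 : Fin 4`) of two operators
`θ, τ` on `𝔤`, for the pairs of eigenvalues `(1, 1), (1, -1), (-1, 1), (-1, -1)`. -/
def jointEigenspace (θ τ : Module.End ℝ 𝔤) : Fin 4 → Submodule ℝ 𝔤 :=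
  ![θ.eigenspace 1 ⊓ τ.eigenspace 1,
    θ.eigenspace 1 ⊓ τ.eigenspace (-1),
    θ.eigenspace (-1) ⊓ τ.eigenspace 1,
    θ.eigenspace (-1) ⊓ τ.eigenspace (-1)]

/-- `q` is a (positive definite) inner product on `𝔤`. -/
structure IsInnerProduct (q : LinearMap.BilinForm ℝ 𝔤) : Prop where
  symm : ∀ x y, q x y = q y x
  pos : ∀ x, x ≠ 0 → 0 < q x x

/-- `B` is an associative inner product: `B([x, y], z) = B(x, [y, z])`. -/
structure IsAssociativeInnerProduct (B : LinearMap.BilinForm ℝ 𝔤) : Prop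
    extends IsInnerProduct B where
  assoc : ∀ x y z, B ⁅x, y⁆ z = B x ⁅y, z⁆

/-- The bilinear form `q` on `𝔤 = 𝔥₁ ⊕ 𝔥₂ ⊕ 𝔥₃ ⊕ 𝔥₄` is
`u₁ B|_𝔥₁ + u₂ B|_𝔥₂ + u₃ B|_𝔥₃ + u₄ B|_𝔥₄`. -/
def IsBlockSum (h : Fin 4 → Submodule ℝ 𝔤) (B : LinearMap.BilinForm ℝ 𝔤) (u : Fin 4 → ℝ)
    (q : LinearMap.BilinForm ℝ 𝔤) : Prop :=
  ∀ i j, ∀ x ∈ h i, ∀ y ∈ h j, q x y = if i = j then u i * B x y else 0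

end LieAlgebraPart

/-! ### Left-invariant metrics on Lie groups

The regularity `minSmoothness ℝ 3` is `C³`; it is the one for which Mathlib equips the tangent
space at the identity with its Lie algebra structure, and smooth Lie groups satisfy it. -/

section LieGroupPart

variable {n : ℕ} {G : Type*} [TopologicalSpace G] [ChartedSpace (EuclideanSpace ℝ (Fin n)) G]
  [Group G]

instance finite_groupLieAlgebra : Module.Finite ℝ (GroupLieAlgebra (𝓡 n) G) :=
  inferInstanceAs (Module.Finite ℝ (EuclideanSpace ℝ (Fin n)))

/-- `Ad(g)`, the derivative at the identity of the conjugation `x ↦ g x g⁻¹`. -/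
def groupAd (g : G) (x : GroupLieAlgebra (𝓡 n) G) : GroupLieAlgebra (𝓡 n) G :=
  mfderiv (𝓡 n) (𝓡 n) (fun a : G => g * a * g⁻¹) 1 x

/-- The subgroup `H` of `G` has Lie algebra `s`: the elements of `s` are the velocities at time zero
of the `C¹` curves in `H` that start at the identity. -/
def HasLieAlgebra (H : Subgroup G) (s : Submodule ℝ (GroupLieAlgebra (𝓡 n) G)) : Prop :=
  ∀ x, x ∈ s ↔ ∃ γ : ℝ → G, ContMDiff 𝓘(ℝ, ℝ) (𝓡 n) 1 γ ∧ γ 0 = 1 ∧ (∀ r, γ r ∈ H) ∧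
    mfderiv 𝓘(ℝ, ℝ) (𝓡 n) γ 0 (1 : ℝ) = x

/-- The inner product `q` on the Lie algebra is invariant under `Ad(H)`. -/
def IsAdInvariant (H : Subgroup G) (q : LinearMap.BilinForm ℝ (GroupLieAlgebra (𝓡 n) G)) : Prop :=
  ∀ g ∈ H, ∀ x y, q (groupAd g x) (groupAd g y) = q x y

/-- Left translation of a tangent vector at `p` to the identity. -/
def toLieAlgebra (p : G) (v : TangentSpace (𝓡 n) p) : GroupLieAlgebra (𝓡 n) G :=
  mfderiv (𝓡 n) (𝓡 n) (fun a : G => p⁻¹ * a) p v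

/-- The left-invariant metric on `G` whose value at the identity is `q`. -/
def leftInvariantMetric (q : LinearMap.BilinForm ℝ (GroupLieAlgebra (𝓡 n) G)) (p : G)
    (v w : TangentSpace (𝓡 n) p) : ℝ :=
  q (toLieAlgebra p v) (toLieAlgebra p w)

variable [LieGroup (𝓡 n) (minSmoothness ℝ 3) G]

/-- `X` is a vector field on `G` that is differentiable at `p`. -/
def VectorFieldDiffAt (X : Π p : G, TangentSpace (𝓡 n) p) (p : G) : Prop :=
  MDifferentiableAt (𝓡 n) (𝓡 n).tangent (fun a => (⟨a, X a⟩ : TangentBundle (𝓡 n) G)) p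

/-- `∇` is the Levi-Civita connection of the metric `m`: it is torsion free and compatible
with `m`. In Mathlib's notation `∇_X Y` at `p` is `∇ Y p (X p)`. -/
structure IsLeviCivita (m : Π p : G, TangentSpace (𝓡 n) p → TangentSpace (𝓡 n) p → ℝ)
    (nabla : CovariantDerivative (𝓡 n) (EuclideanSpace ℝ (Fin n))
      (TangentSpace (𝓡 n) : G → Type _)) : Prop where
  torsion_free : ∀ (X Y : Π p : G, TangentSpace (𝓡 n) p) (p : G),
    VectorFieldDiffAt X p → VectorFieldDiffAt Y p →
      nabla Y p (X p) - nabla X p (Y p) = VectorField.mlieBracket (𝓡 n) X Y p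
  compatible : ∀ (X Y : Π p : G, TangentSpace (𝓡 n) p) (p : G) (v : TangentSpace (𝓡 n) p),
    VectorFieldDiffAt X p → VectorFieldDiffAt Y p →
      mvfderiv (𝓡 n) (fun a => m a (X a) (Y a)) p v =
        m p (nabla X p v) (Y p) + m p (X p) (nabla Y p v)

/-- The curvature `R(X, Y)Z = ∇_X ∇_Y Z - ∇_Y ∇_X Z - ∇_{[X, Y]} Z` of a connection. -/
def curvature (nabla : CovariantDerivative (𝓡 n) (EuclideanSpace ℝ (Fin n))
      (TangentSpace (𝓡 n) : G → Type _))
    (X Y Z : Π p : G, TangentSpace (𝓡 n) p) (p : G) : TangentSpace (𝓡 n) p :=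
  nabla (fun a => nabla Z a (Y a)) p (X p) - nabla (fun a => nabla Z a (X a)) p (Y p)
    - nabla Z p (VectorField.mlieBracket (𝓡 n) X Y p)

/-- The Ricci curvature `Ric(Y, Z) = tr (v ↦ R(v, Y)Z)` of a connection. The trace is computed in
a global frame of left-invariant vector fields. -/
def ricci (nabla : CovariantDerivative (𝓡 n) (EuclideanSpace ℝ (Fin n))
      (TangentSpace (𝓡 n) : G → Type _))
    (Y Z : Π p : G, TangentSpace (𝓡 n) p) (p : G) : ℝ :=
  ∑ i, (Module.finBasis ℝ (GroupLieAlgebra (𝓡 n) G)).coord i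
    (toLieAlgebra p (curvature nabla
      (mulInvariantVectorField (Module.finBasis ℝ (GroupLieAlgebra (𝓡 n) G) i)) Y Z p))

/-- The metric `m` with Levi-Civita connection `∇` is Einstein: `Ric = c m` for a constant `c`.
It is enough to test on left-invariant vector fields, which span every tangent space. -/
def IsEinstein (m : Π p : G, TangentSpace (𝓡 n) p → TangentSpace (𝓡 n) p → ℝ)
    (nabla : CovariantDerivative (𝓡 n) (EuclideanSpace ℝ (Fin n))
      (TangentSpace (𝓡 n) : G → Type _)) : Prop :=
  ∃ c : ℝ, ∀ (x y : GroupLieAlgebra (𝓡 n) G) (p : G),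
    ricci nabla (mulInvariantVectorField x) (mulInvariantVectorField y) p =
      c * m p (mulInvariantVectorField x p) (mulInvariantVectorField y p)

end LieGroupPart

end EinsteinF4

end

/-!
The operators `θ` and `τ` are commuting involutive automorphisms, so the joint eigenspaces are the
components of a grading of the Lie algebra `L` of `G` by the Klein four-group. On the root space of
`∑ aⱼ αⱼ` the operator `θ` is the sign of the parity of `a₄` and `τ` that of `a₃`. Hence `h 0` is the
Cartan subalgebra together with the 24 long roots, which form a subsystem of type `D₄`, and each of
the other components consists of 8 short roots. The grading is by `𝔰𝔬(8)` and its vector and two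
half-spin representations.

*Schur's lemma.* An endomorphism that commutes with `h 0` acts on each complexified component by one
scalar (`exists_eq_smul_of_commute`): it preserves the root lines, and raising by simple roots of
`D₄` leads from every root to the highest weight of its component (`exists_add_mem_f4Roots`). The
scalar is real because the endomorphism is. So every bilinear form that is infinitesimally invariant
under `h 0` is a multiple of `B` on each component and makes different components orthogonal. An
`Ad(H₁)`-invariant metric is such a form: differentiate the invariance along the curves in `H₁`,
using that the derivative of `Ad` is `ad` (`hasDerivAt_groupAd_curve`).

*Ricci curvature.* On left-invariant fields the Levi-Civita connection is given by the Koszul formula,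
which for the metric `(*)` makes `∇_x y` a multiple of `⁅x, y⁆` for `x`, `y` in components of the
grading. So the Ricci curvature is a combination of the partial Killing forms
`(y, z) ↦ tr (ad y ∘ ad z ∘ P k)`, with `P k` the projection to the `k`-th component. These are
invariant under `h 0`, hence multiples `l i k` of `B` on the `i`-th component. Up to a common factor
the numbers `l i k` follow from the dimensions 28, 8, 8, 8 of the components, the traces
`tr ((ad T)² ∘ P k)`, which are in the ratio `6 : 1 : 1 : 1`, and three symmetries of the partial
Killing forms (`exists_partialKilling_table`). Substituting them gives the equations of the statement
(`exists_ricciCoeff_eq_iff`).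

The properties of the grading that both parts use are collected in `IsSpinGrading`, and
`FundamentalSystemF4.IsSignPair.isSpinGrading` establishes them from the root system.
-/

/-! ### The derivative of the adjoint representation -/

namespace EinsteinF4
section AdjointDerivative
open VectorField Set Filter Topology

variable {n : ℕ} {G : Type*} [TopologicalSpace G] [ChartedSpace (EuclideanSpace ℝ (Fin n)) G]
  [Group G]

variable (n G) in
/-- The group law read in the preferred chart at the identity. -/
noncomputable def chartMul (p : EuclideanSpace ℝ (Fin n) × EuclideanSpace ℝ (Fin n)) :
    EuclideanSpace ℝ (Fin n) :=
  extChartAt (𝓡 n) (1 : G)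
    ((extChartAt (𝓡 n) (1 : G)).symm p.1 * (extChartAt (𝓡 n) (1 : G)).symm p.2)

variable (n G) in
/-- The image of the identity in the preferred chart at the identity. -/
noncomputable def chartOne : EuclideanSpace ℝ (Fin n) := extChartAt (𝓡 n) (1 : G) 1

/-- The tangent space at `1` is the model space through the preferred chart at `1`, so a derivative at
`1` is the derivative in this chart. -/
lemma mfderiv_eq_fderiv_comp_chart_symm {h : G → EuclideanSpace ℝ (Fin n)}
    (hh : MDifferentiableAt (𝓡 n) 𝓘(ℝ, EuclideanSpace ℝ (Fin n)) h 1) :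
    mfderiv (𝓡 n) 𝓘(ℝ, EuclideanSpace ℝ (Fin n)) h 1 =
      fderiv ℝ (h ∘ (extChartAt (𝓡 n) (1 : G)).symm) (chartOne n G) := by
  have key : ∀ (f : EuclideanSpace ℝ (Fin n) → EuclideanSpace ℝ (Fin n))
      (D : EuclideanSpace ℝ (Fin n) →L[ℝ] EuclideanSpace ℝ (Fin n)) (x : EuclideanSpace ℝ (Fin n)),
      HasFDerivWithinAt f D (range (𝓡 n)) x → D = fderiv ℝ f x := by
    intro f D x hD
    rw [ModelWithCorners.range_eq_univ, hasFDerivWithinAt_univ] at hD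
    exact hD.fderiv.symm
  exact key _ _ _ hh.hasMFDerivAt.2

lemma groupAd_one (x : GroupLieAlgebra (𝓡 n) G) : groupAd (1 : G) x = x := by
  have h : (fun a : G => 1 * a * 1⁻¹) = id := by funext a; simp
  rw [groupAd, h]
  exact DFunLike.congr_fun (mfderiv_id (I := 𝓡 n)) x

variable [LieGroup (𝓡 n) (minSmoothness ℝ 3) G]

lemma isManifold_three : IsManifold (𝓡 n) 3 G := by
  have h : LieGroup (𝓡 n) (minSmoothness ℝ 3) G := inferInstance
  rw [minSmoothness_of_isRCLikeNormedField] at h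
  infer_instance

lemma isManifold_one : IsManifold (𝓡 n) 1 G :=
  have := isManifold_three (n := n) (G := G)
  IsManifold.of_le (n := 3) (by norm_num)

lemma contMDiff_mul_three : ContMDiff ((𝓡 n).prod (𝓡 n)) (𝓡 n) 3 fun p : G × G => p.1 * p.2 := by
  have h : LieGroup (𝓡 n) (minSmoothness ℝ 3) G := inferInstance
  rw [minSmoothness_of_isRCLikeNormedField] at h
  exact contMDiff_mul (𝓡 n) 3

lemma mdifferentiableAt_mul_left {g a : G} :
    MDifferentiableAt (𝓡 n) (𝓡 n) (fun x : G => g * x) a :=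
  (contMDiff_mul_left (n := minSmoothness ℝ 3)).mdifferentiableAt (by simp)

lemma mdifferentiableAt_mul_right {g a : G} :
    MDifferentiableAt (𝓡 n) (𝓡 n) (fun x : G => x * g) a :=
  (contMDiff_mul_right (n := minSmoothness ℝ 3)).mdifferentiableAt (by simp)

lemma contDiffAt_chartMul : ContDiffAt ℝ 3 (chartMul n G) (chartOne n G, chartOne n G) := by
  have := isManifold_three (n := n) (G := G)
  have hs : ContMDiffAt 𝓘(ℝ, EuclideanSpace ℝ (Fin n)) (𝓡 n) 3
      (extChartAt (𝓡 n) (1 : G)).symm (chartOne n G) :=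
    (contMDiffOn_extChartAt_symm (1 : G)).contMDiffAt (extChartAt_target_mem_nhds _)
  have e1 : (extChartAt (𝓡 n) (1 : G)).symm (chartOne n G) = 1 := extChartAt_to_inv _
  have h1 : ContMDiffAt (𝓡 n) 𝓘(ℝ, EuclideanSpace ℝ (Fin n)) 3
      (extChartAt (𝓡 n) (1 : G)) 1 := contMDiffAt_extChartAt
  have h2 := contMDiff_mul_three (n := n) (G := G)
  have h3 : ContMDiffAt (𝓘(ℝ, EuclideanSpace ℝ (Fin n)).prod 𝓘(ℝ, EuclideanSpace ℝ (Fin n)))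
      ((𝓡 n).prod (𝓡 n)) 3
      (fun p : EuclideanSpace ℝ (Fin n) × EuclideanSpace ℝ (Fin n) =>
        ((extChartAt (𝓡 n) (1 : G)).symm p.1, (extChartAt (𝓡 n) (1 : G)).symm p.2))
      (chartOne n G, chartOne n G) :=
    (hs.comp (chartOne n G, chartOne n G) contMDiffAt_fst).prodMk
      (hs.comp (chartOne n G, chartOne n G) contMDiffAt_snd)
  have h4 := (h2.contMDiffAt).comp (chartOne n G, chartOne n G) h3
  have h5 : ContMDiffAt (𝓘(ℝ, EuclideanSpace ℝ (Fin n)).prod 𝓘(ℝ, EuclideanSpace ℝ (Fin n)))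
      𝓘(ℝ, EuclideanSpace ℝ (Fin n)) 3 (chartMul n G) (chartOne n G, chartOne n G) :=
    ContMDiffAt.comp (chartOne n G, chartOne n G) (g := extChartAt (𝓡 n) (1 : G))
      (by
        change ContMDiffAt _ _ _ _ ((extChartAt (𝓡 n) (1 : G)).symm (chartOne n G) *
          (extChartAt (𝓡 n) (1 : G)).symm (chartOne n G))
        rw [e1, mul_one]
        exact h1) h4
  rw [← modelWithCornersSelf_prod, chartedSpaceSelf_prod] at h5
  exact contMDiffAt_iff_contDiffAt.1 h5

lemma eventually_differentiableAt_chartMul :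
    ∀ᶠ p in 𝓝 (chartOne n G, chartOne n G), DifferentiableAt ℝ (chartMul n G) p := by
  filter_upwards [(contDiffAt_chartMul (n := n) (G := G)).eventually (by simp)] with p hp
  exact hp.differentiableAt (by simp)

lemma differentiableAt_fderiv_chartMul :
    DifferentiableAt ℝ (fderiv ℝ (chartMul n G)) (chartOne n G, chartOne n G) :=
  ((contDiffAt_chartMul (n := n) (G := G)).fderiv_right (m := 2) (by norm_num)).differentiableAt
    (by norm_num)

lemma mfderiv_chart_one :
    mfderiv (𝓡 n) 𝓘(ℝ, EuclideanSpace ℝ (Fin n)) (extChartAt (𝓡 n) (1 : G)) 1 =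
      ContinuousLinearMap.id ℝ (EuclideanSpace ℝ (Fin n)) := by
  have := isManifold_one (n := n) (G := G)
  rw [mfderiv_eq_fderiv_comp_chart_symm
    (mdifferentiableAt_extChartAt (mem_chart_source _ _))]
  have : extChartAt (𝓡 n) (1 : G) ∘ (extChartAt (𝓡 n) (1 : G)).symm =ᶠ[𝓝 (chartOne n G)] id := by
    filter_upwards [extChartAt_target_mem_nhds (I := 𝓡 n) (1 : G)] with x hx
    exact (extChartAt (𝓡 n) (1 : G)).right_inv hx
  rw [this.fderiv_eq, fderiv_id]

/-- In the chart, with group law `m`, the left-invariant field of `v` is `x ↦ D₂m(x, 1) v`. -/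
lemma mfderiv_chart_mulInvariantVectorField (v : GroupLieAlgebra (𝓡 n) G) {g : G}
    (hg : g ∈ (extChartAt (𝓡 n) (1 : G)).source)
    (hd : DifferentiableAt ℝ (chartMul n G) (extChartAt (𝓡 n) (1 : G) g, chartOne n G)) :
    mfderiv (𝓡 n) 𝓘(ℝ, EuclideanSpace ℝ (Fin n)) (extChartAt (𝓡 n) (1 : G)) g
        (mulInvariantVectorField v g) =
      fderiv ℝ (chartMul n G) (extChartAt (𝓡 n) (1 : G) g, chartOne n G) (0, v) := by
  have := isManifold_one (n := n) (G := G)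
  have hφ : MDifferentiableAt (𝓡 n) 𝓘(ℝ, EuclideanSpace ℝ (Fin n)) (extChartAt (𝓡 n) (1 : G)) g :=
    mdifferentiableAt_extChartAt (by simpa using hg)
  have hφ' : MDifferentiableAt (𝓡 n) 𝓘(ℝ, EuclideanSpace ℝ (Fin n))
      (extChartAt (𝓡 n) (1 : G)) (g * 1) := by simpa using hφ
  have h2 : mfderiv (𝓡 n) 𝓘(ℝ, EuclideanSpace ℝ (Fin n))
      ((extChartAt (𝓡 n) (1 : G)) ∘ fun x => g * x) 1 v =
      fderiv ℝ (chartMul n G) (extChartAt (𝓡 n) (1 : G) g, chartOne n G) (0, v) := by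
    rw [mfderiv_eq_fderiv_comp_chart_symm (hφ'.comp (1 : G) mdifferentiableAt_mul_left)]
    have h3 : ((extChartAt (𝓡 n) (1 : G)) ∘ fun x => g * x) ∘ (extChartAt (𝓡 n) (1 : G)).symm =
        chartMul n G ∘ fun x => (extChartAt (𝓡 n) (1 : G) g, x) := by
      funext x
      simp only [chartMul, Function.comp_apply, (extChartAt (𝓡 n) (1 : G)).left_inv hg]
    rw [h3, fderiv_comp _ hd (by fun_prop)]
    have h4 : HasFDerivAt (fun x => (extChartAt (𝓡 n) (1 : G) g, x))
        (ContinuousLinearMap.inr ℝ (EuclideanSpace ℝ (Fin n)) (EuclideanSpace ℝ (Fin n)))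
        (chartOne n G) := hasFDerivAt_prodMk_right _ _
    rw [h4.fderiv]
    rfl
  rw [← h2]
  have h5 : HasMFDerivAt (𝓡 n) 𝓘(ℝ, EuclideanSpace ℝ (Fin n))
      ((extChartAt (𝓡 n) (1 : G)) ∘ fun x => g * x) 1 _ :=
    HasMFDerivAt.comp (1 : G)
      (g' := mfderiv (𝓡 n) 𝓘(ℝ, EuclideanSpace ℝ (Fin n)) (extChartAt (𝓡 n) (1 : G)) g)
      (by rw [mul_one]; exact hφ.hasMFDerivAt)
      (mdifferentiableAt_mul_left (n := n) (g := g)).hasMFDerivAt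
  exact (DFunLike.congr_fun h5.mfderiv v).symm

lemma mfderiv_chart_mul_right (v : GroupLieAlgebra (𝓡 n) G) {g : G}
    (hg : g ∈ (extChartAt (𝓡 n) (1 : G)).source)
    (hd : DifferentiableAt ℝ (chartMul n G) (chartOne n G, extChartAt (𝓡 n) (1 : G) g)) :
    mfderiv (𝓡 n) 𝓘(ℝ, EuclideanSpace ℝ (Fin n)) (extChartAt (𝓡 n) (1 : G) ∘ fun x => x * g) 1 v =
      fderiv ℝ (chartMul n G) (chartOne n G, extChartAt (𝓡 n) (1 : G) g) (v, 0) := by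
  have := isManifold_one (n := n) (G := G)
  have hφ : MDifferentiableAt (𝓡 n) 𝓘(ℝ, EuclideanSpace ℝ (Fin n))
      (extChartAt (𝓡 n) (1 : G)) (1 * g) :=
    mdifferentiableAt_extChartAt (by simpa using hg)
  rw [mfderiv_eq_fderiv_comp_chart_symm (hφ.comp (1 : G) mdifferentiableAt_mul_right)]
  have h3 : ((extChartAt (𝓡 n) (1 : G)) ∘ fun x => x * g) ∘ (extChartAt (𝓡 n) (1 : G)).symm =
      chartMul n G ∘ fun x => (x, extChartAt (𝓡 n) (1 : G) g) := by
    funext x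
    simp only [chartMul, Function.comp_apply, (extChartAt (𝓡 n) (1 : G)).left_inv hg]
  have h4 : HasFDerivAt (fun x => (x, extChartAt (𝓡 n) (1 : G) g))
      (ContinuousLinearMap.inl ℝ (EuclideanSpace ℝ (Fin n)) (EuclideanSpace ℝ (Fin n)))
      (chartOne n G) := hasFDerivAt_prodMk_left _ _
  rw [h3, (HasFDerivAt.comp (f := fun x => (x, extChartAt (𝓡 n) (1 : G) g)) (chartOne n G)
    hd.hasFDerivAt h4).fderiv]
  rfl

lemma eventually_mpullback_chart_mulInvariantVectorField (v : GroupLieAlgebra (𝓡 n) G) :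
    ∀ᶠ x in 𝓝 (chartOne n G),
      mpullbackWithin 𝓘(ℝ, EuclideanSpace ℝ (Fin n)) (𝓡 n) (extChartAt (𝓡 n) (1 : G)).symm
        (mulInvariantVectorField v) (range (𝓡 n)) x =
      fderiv ℝ (chartMul n G) (x, chartOne n G) (0, v) := by
  have := isManifold_one (n := n) (G := G)
  have h1 : Tendsto (fun x => (x, chartOne n G)) (𝓝 (chartOne n G))
      (𝓝 (chartOne n G, chartOne n G)) := Continuous.tendsto (by fun_prop) _
  filter_upwards [extChartAt_target_mem_nhds (I := 𝓡 n) (1 : G),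
    h1.eventually eventually_differentiableAt_chartMul] with x hx hd
  have e : extChartAt (𝓡 n) (1 : G) ((extChartAt (𝓡 n) (1 : G)).symm x) = x :=
    (extChartAt (𝓡 n) (1 : G)).right_inv hx
  have h2 := mfderiv_chart_mulInvariantVectorField v
    ((extChartAt (𝓡 n) (1 : G)).map_target hx) (by rw [e]; exact hd)
  rw [e] at h2
  have h3 := ContinuousLinearMap.inverse_eq
    (mfderivWithin_extChartAt_symm_comp_mfderiv_extChartAt hx)
    (mfderiv_extChartAt_comp_mfderivWithin_extChartAt_symm hx)
  exact (DFunLike.congr_fun h3 _).trans h2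

variable (n G) in
/-- The second derivative of the group law at the identity, read in the preferred chart. -/
noncomputable def chartMulHess : EuclideanSpace ℝ (Fin n) × EuclideanSpace ℝ (Fin n) →L[ℝ]
    EuclideanSpace ℝ (Fin n) × EuclideanSpace ℝ (Fin n) →L[ℝ] EuclideanSpace ℝ (Fin n) :=
  fderiv ℝ (fderiv ℝ (chartMul n G)) (chartOne n G, chartOne n G)

lemma chartMulHess_symm (a b : EuclideanSpace ℝ (Fin n) × EuclideanSpace ℝ (Fin n)) :
    chartMulHess n G a b = chartMulHess n G b a :=
  (contDiffAt_chartMul (n := n) (G := G)).isSymmSndFDerivAt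
    (by rw [minSmoothness_of_isRCLikeNormedField]; norm_num) a b

lemma hasFDerivAt_fderiv_chartMul_left (v : EuclideanSpace ℝ (Fin n) × EuclideanSpace ℝ (Fin n)) :
    HasFDerivAt (fun x => fderiv ℝ (chartMul n G) (x, chartOne n G) v)
      (((chartMulHess n G).comp (ContinuousLinearMap.inl ℝ _ _)).flip v) (chartOne n G) := by
  have h4 : HasFDerivAt (fun x => (x, chartOne n G))
      (ContinuousLinearMap.inl ℝ (EuclideanSpace ℝ (Fin n)) (EuclideanSpace ℝ (Fin n)))
      (chartOne n G) := hasFDerivAt_prodMk_left _ _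
  have h5 := HasFDerivAt.comp (f := fun x => (x, chartOne n G)) (chartOne n G)
    (differentiableAt_fderiv_chartMul (n := n) (G := G)).hasFDerivAt h4
  refine (h5.clm_apply (hasFDerivAt_const v _)).congr_fderiv ?_
  ext1 w
  simp [chartMulHess]

/-- The Lie bracket is the antisymmetrization of `D₁D₂m`, the mixed second derivative of the group law
`m` in the chart. -/
lemma lie_eq_chartMulHess (v w : GroupLieAlgebra (𝓡 n) G) :
    ⁅v, w⁆ = chartMulHess n G (v, 0) (0, w) - chartMulHess n G (w, 0) (0, v) := by
  have h0 : ∀ v : GroupLieAlgebra (𝓡 n) G,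
      fderiv ℝ (chartMul n G) (chartOne n G, chartOne n G) (0, v) = v := by
    intro v
    have h := mfderiv_chart_mulInvariantVectorField v (g := (1 : G))
      (mem_extChartAt_source _) eventually_differentiableAt_chartMul.self_of_nhds
    refine h.symm.trans ?_
    have h1 : mulInvariantVectorField v (1 : G) = v := by
      have h2 := (hasMFDerivAt_id (I := 𝓡 n) (1 : G)).congr_of_eventuallyEq
        (f₁ := fun x => 1 * x) (Eventually.of_forall one_mul)
      exact DFunLike.congr_fun h2.mfderiv v
    rw [h1]
    exact DFunLike.congr_fun mfderiv_chart_one v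
  have hb : lieBracket ℝ (fun x => fderiv ℝ (chartMul n G) (x, chartOne n G) (0, v))
      (fun x => fderiv ℝ (chartMul n G) (x, chartOne n G) (0, w)) (chartOne n G) =
      chartMulHess n G (v, 0) (0, w) - chartMulHess n G (w, 0) (0, v) := by
    rw [lieBracket, (hasFDerivAt_fderiv_chartMul_left (0, w)).fderiv,
      (hasFDerivAt_fderiv_chartMul_left (0, v)).fderiv, h0, h0]
    rfl
  rw [← hb, GroupLieAlgebra.bracket_def, ← mlieBracketWithin_univ, mlieBracketWithin_apply]
  have h1 : (mfderiv (𝓡 n) 𝓘(ℝ, EuclideanSpace ℝ (Fin n)) (extChartAt (𝓡 n) (1 : G)) 1).inverse =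
      ContinuousLinearMap.id ℝ (EuclideanSpace ℝ (Fin n)) := by
    rw [mfderiv_chart_one]
    exact ContinuousLinearMap.inverse_id
  refine (DFunLike.congr_fun h1 _).trans ?_
  have h2 : (extChartAt (𝓡 n) (1 : G)).symm ⁻¹' univ ∩ range (𝓡 n) = univ := by simp
  have h3 : ∀ (V W : EuclideanSpace ℝ (Fin n) → EuclideanSpace ℝ (Fin n))
      (s : Set (EuclideanSpace ℝ (Fin n))) (x : EuclideanSpace ℝ (Fin n)), s = univ →
      lieBracketWithin ℝ V W s x = lieBracket ℝ V W x := by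
    rintro V W _ x rfl
    rw [lieBracketWithin_univ]
  exact (h3 _ _ _ _ h2).trans (Filter.EventuallyEq.lieBracket_vectorField_eq
    (eventually_mpullback_chart_mulInvariantVectorField v)
    (eventually_mpullback_chart_mulInvariantVectorField w))

/-- The derivative of `(g a g⁻¹) g = g a` at `a = 1`. -/
lemma mfderiv_conj_mul_right (g : G) (w : GroupLieAlgebra (𝓡 n) G)
    (hg : g ∈ (extChartAt (𝓡 n) (1 : G)).source) :
    mfderiv (𝓡 n) 𝓘(ℝ, EuclideanSpace ℝ (Fin n)) (extChartAt (𝓡 n) (1 : G) ∘ fun x => x * g) 1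
        (groupAd g w) =
      mfderiv (𝓡 n) 𝓘(ℝ, EuclideanSpace ℝ (Fin n)) (extChartAt (𝓡 n) (1 : G)) g
        (mulInvariantVectorField w g) := by
  have := isManifold_one (n := n) (G := G)
  have hφ : MDifferentiableAt (𝓡 n) 𝓘(ℝ, EuclideanSpace ℝ (Fin n)) (extChartAt (𝓡 n) (1 : G)) g :=
    mdifferentiableAt_extChartAt (by simpa using hg)
  have hc : HasMFDerivAt (𝓡 n) (𝓡 n) (fun a : G => g * a * g⁻¹) 1
      (mfderiv (𝓡 n) (𝓡 n) (fun a : G => g * a * g⁻¹) 1) :=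
    (MDifferentiableAt.comp (1 : G) (mdifferentiableAt_mul_right (n := n) (g := g⁻¹))
      (mdifferentiableAt_mul_left (n := n) (g := g))).hasMFDerivAt
  have hr : MDifferentiableAt (𝓡 n) 𝓘(ℝ, EuclideanSpace ℝ (Fin n))
      (extChartAt (𝓡 n) (1 : G) ∘ fun x => x * g) 1 :=
    MDifferentiableAt.comp (1 : G) (by rw [one_mul]; exact hφ) mdifferentiableAt_mul_right
  have h1 : HasMFDerivAt (𝓡 n) 𝓘(ℝ, EuclideanSpace ℝ (Fin n))
      ((extChartAt (𝓡 n) (1 : G) ∘ fun x => x * g) ∘ fun a : G => g * a * g⁻¹) 1 _ :=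
    HasMFDerivAt.comp (1 : G) (g' := mfderiv (𝓡 n) 𝓘(ℝ, EuclideanSpace ℝ (Fin n))
      (extChartAt (𝓡 n) (1 : G) ∘ fun x => x * g) 1)
      (by rw [mul_one, mul_inv_cancel]; exact hr.hasMFDerivAt) hc
  have h2 : HasMFDerivAt (𝓡 n) 𝓘(ℝ, EuclideanSpace ℝ (Fin n))
      ((extChartAt (𝓡 n) (1 : G)) ∘ fun x => g * x) 1 _ :=
    HasMFDerivAt.comp (1 : G)
      (g' := mfderiv (𝓡 n) 𝓘(ℝ, EuclideanSpace ℝ (Fin n)) (extChartAt (𝓡 n) (1 : G)) g)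
      (by rw [mul_one]; exact hφ.hasMFDerivAt)
      (mdifferentiableAt_mul_left (n := n) (g := g)).hasMFDerivAt
  have h3 : ((extChartAt (𝓡 n) (1 : G) ∘ fun x => x * g) ∘ fun a : G => g * a * g⁻¹) =
      (extChartAt (𝓡 n) (1 : G)) ∘ fun x => g * x := by
    funext x; simp only [Function.comp_apply, inv_mul_cancel_right]
  have h4 := h2.congr_of_eventuallyEq (Eventually.of_forall (congrFun h3))
  exact DFunLike.congr_fun (hasMFDerivAt_unique h1 h4) w

/-- The derivative of the solution `A` of the linear equation `M A = L` at a time when `M` is the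
identity. -/
lemma _root_.HasDerivAt.of_clm_apply_eq {E : Type*} [NormedAddCommGroup E] [NormedSpace ℝ E]
    [CompleteSpace E] {M : ℝ → E →L[ℝ] E} {M' : E →L[ℝ] E} {L A : ℝ → E} {L' : E} {t₀ : ℝ}
    (hM : HasDerivAt M M' t₀) (hM0 : M t₀ = 1) (hL : HasDerivAt L L' t₀)
    (h : ∀ᶠ t in 𝓝 t₀, M t (A t) = L t) : HasDerivAt A (L' - M' (L t₀)) t₀ := by
  have hunit : ∀ᶠ t in 𝓝 t₀, IsUnit (M t) :=
    hM.continuousAt.eventually_mem (by rw [hM0]; exact Units.isOpen.mem_nhds isUnit_one)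
  have heq : A =ᶠ[𝓝 t₀] fun t => Ring.inverse (M t) (L t) := by
    filter_upwards [h, hunit] with t h5 h4
    rw [← h5, ← ContinuousLinearMap.comp_apply, ← ContinuousLinearMap.mul_def,
      Ring.inverse_mul_cancel _ h4]
    rfl
  have hinv : HasDerivAt (fun t => Ring.inverse (M t)) (-M') t₀ := by
    have h1 := hasFDerivAt_ringInverse (𝕜 := ℝ) (1 : (E →L[ℝ] E)ˣ)
    rw [Units.val_one, ← hM0] at h1
    refine (h1.comp_hasDerivAt t₀ hM).congr_deriv ?_
    ext1 u
    simp
  refine ((hinv.clm_apply hL).congr_of_eventuallyEq heq).congr_deriv ?_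
  rw [hM0, Ring.inverse_one]
  simp [sub_eq_neg_add]

/-- The derivative of `Ad` along a curve is `ad` of its velocity: differentiating
`D₂m(γ, 1) w = D₁m(1, γ) (Ad(γ) w)`, where `m` is the group law in a chart, gives
`D₁D₂m(v, w) = D₂D₁m(w, v) + (Ad(γ) w)'`. -/
theorem hasDerivAt_groupAd_curve {γ : ℝ → G} (hγ : ContMDiff 𝓘(ℝ, ℝ) (𝓡 n) 1 γ) (hγ0 : γ 0 = 1)
    {v : GroupLieAlgebra (𝓡 n) G} (hv : mfderiv 𝓘(ℝ, ℝ) (𝓡 n) γ 0 (1 : ℝ) = v)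
    (w : GroupLieAlgebra (𝓡 n) G) :
    HasDerivAt (F := EuclideanSpace ℝ (Fin n)) (fun t => groupAd (γ t) w)
      (LieAlgebra.ad ℝ (GroupLieAlgebra (𝓡 n) G) v w) 0 := by
  -- `v'` and `w'` are `v` and `w` as elements of the model space, which carries the norm
  obtain ⟨v', hv'⟩ : ∃ v' : EuclideanSpace ℝ (Fin n), v' = v := ⟨_, rfl⟩
  obtain ⟨w', hw'⟩ : ∃ w' : EuclideanSpace ℝ (Fin n), w' = w := ⟨_, rfl⟩
  have := isManifold_one (n := n) (G := G)
  set c : ℝ → EuclideanSpace ℝ (Fin n) := extChartAt (𝓡 n) (1 : G) ∘ γ with hc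
  have hc0 : c 0 = chartOne n G := by simp only [hc, Function.comp_apply, hγ0, chartOne]
  have hsrc : ∀ᶠ t in 𝓝 (0 : ℝ), γ t ∈ (extChartAt (𝓡 n) (1 : G)).source := by
    refine hγ.continuous.continuousAt.eventually_mem ?_
    rw [hγ0]
    exact extChartAt_source_mem_nhds _
  have hcd : HasDerivAt c v' 0 := by
    have h1 : HasMFDerivAt 𝓘(ℝ, ℝ) 𝓘(ℝ, EuclideanSpace ℝ (Fin n)) c 0 _ :=
      HasMFDerivAt.comp (0 : ℝ)
        (g' := mfderiv (𝓡 n) 𝓘(ℝ, EuclideanSpace ℝ (Fin n)) (extChartAt (𝓡 n) (1 : G)) 1)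
        (by
          rw [hγ0]
          exact (mdifferentiableAt_extChartAt (mem_chart_source _ _)).hasMFDerivAt)
        (hγ.mdifferentiableAt (by simp)).hasMFDerivAt
    have key : ∀ D : ℝ →L[ℝ] EuclideanSpace ℝ (Fin n),
        HasMFDerivAt 𝓘(ℝ, ℝ) 𝓘(ℝ, EuclideanSpace ℝ (Fin n)) c 0 D → HasDerivAt c (D 1) 0 :=
      fun D hD => have hD' : HasFDerivAt c D 0 := hasMFDerivAt_iff_hasFDerivAt.1 hD
      hD'.hasDerivAt
    have h2 := key _ h1
    have h3 : mfderiv (𝓡 n) 𝓘(ℝ, EuclideanSpace ℝ (Fin n)) (extChartAt (𝓡 n) (1 : G)) 1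
        (mfderiv 𝓘(ℝ, ℝ) (𝓡 n) γ 0 (1 : ℝ)) = v' :=
      hv' ▸ (DFunLike.congr_fun (mfderiv_chart_one (n := n) (G := G)) _).trans hv
    exact h2.congr_deriv h3
  have hcl : HasDerivAt (fun t => (c t, chartOne n G)) (v', (0 : EuclideanSpace ℝ (Fin n))) 0 :=
    hcd.prodMk (hasDerivAt_const _ _)
  have hcr : HasDerivAt (fun t => (chartOne n G, c t)) ((0 : EuclideanSpace ℝ (Fin n)), v') 0 :=
    (hasDerivAt_const _ _).prodMk hcd
  have hF := (differentiableAt_fderiv_chartMul (n := n) (G := G)).hasFDerivAt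
  have hl : HasDerivAt (fun t => fderiv ℝ (chartMul n G) (c t, chartOne n G) (0, w'))
      (chartMulHess n G (v', 0) (0, w')) 0 := by
    have h1 := HasFDerivAt.comp_hasDerivAt (f := fun t => (c t, chartOne n G)) (0 : ℝ)
      (by simpa only [hc0] using hF) hcl
    refine (h1.clm_apply (hasDerivAt_const (0 : ℝ)
      ((0 : EuclideanSpace ℝ (Fin n)), w'))).congr_deriv ?_
    simp [chartMulHess]
  set M : ℝ → EuclideanSpace ℝ (Fin n) →L[ℝ] EuclideanSpace ℝ (Fin n) := fun t =>
    (fderiv ℝ (chartMul n G) (chartOne n G, c t)).comp (ContinuousLinearMap.inl ℝ _ _) with hM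
  have hMd : HasDerivAt M ((chartMulHess n G (0, v')).comp (ContinuousLinearMap.inl ℝ _ _)) 0 := by
    have h1 := HasFDerivAt.comp_hasDerivAt (f := fun t => (chartOne n G, c t)) (0 : ℝ)
      (by simpa only [hc0] using hF) hcr
    simpa [chartMulHess, Function.comp_def] using h1.clm_comp (hasDerivAt_const (0 : ℝ)
      (ContinuousLinearMap.inl ℝ (EuclideanSpace ℝ (Fin n)) (EuclideanSpace ℝ (Fin n))))
  have hM0 : M 0 = 1 := by
    ext1 u
    have h1 := mfderiv_chart_mul_right (n := n) u (g := (1 : G))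
      (mem_extChartAt_source _) eventually_differentiableAt_chartMul.self_of_nhds
    have h2 : (extChartAt (𝓡 n) (1 : G) ∘ fun x => x * 1) = extChartAt (𝓡 n) (1 : G) := by
      funext x; simp only [Function.comp_apply, mul_one]
    have h3 : M 0 u = fderiv ℝ (chartMul n G) (chartOne n G, extChartAt (𝓡 n) (1 : G) 1) (u, 0) := by
      simp only [hM, hc0, chartOne, ContinuousLinearMap.comp_apply, ContinuousLinearMap.inl_apply]
    rw [h3, ← h1, mfderiv_congr h2]
    exact DFunLike.congr_fun (mfderiv_chart_one (n := n) (G := G)) u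
  have hcc : Tendsto c (𝓝 0) (𝓝 (chartOne n G)) := hc0 ▸ hcd.continuousAt.tendsto
  have hdl : ∀ᶠ t in 𝓝 (0 : ℝ), DifferentiableAt ℝ (chartMul n G) (c t, chartOne n G) :=
    (hcc.prodMk_nhds tendsto_const_nhds).eventually eventually_differentiableAt_chartMul
  have hdr : ∀ᶠ t in 𝓝 (0 : ℝ), DifferentiableAt ℝ (chartMul n G) (chartOne n G, c t) :=
    (tendsto_const_nhds.prodMk_nhds hcc).eventually eventually_differentiableAt_chartMul
  have heq : ∀ᶠ t in 𝓝 (0 : ℝ), M t (groupAd (γ t) w) =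
      fderiv ℝ (chartMul n G) (c t, chartOne n G) (0, w') := by
    filter_upwards [hsrc, hdl, hdr] with t h1 h2 h3
    rw [hw']
    refine Eq.trans ?_ ((mfderiv_conj_mul_right (γ t) w h1).trans
      (mfderiv_chart_mulInvariantVectorField w h1 h2))
    exact (mfderiv_chart_mul_right (groupAd (γ t) w) h1 h3).symm
  have h0 : fderiv ℝ (chartMul n G) (c 0, chartOne n G) (0, w') = w' := by
    refine heq.self_of_nhds.symm.trans ?_
    rw [hM0, hγ0]
    exact (groupAd_one w).trans hw'.symm
  refine (HasDerivAt.of_clm_apply_eq hMd hM0 hl heq).congr_deriv ?_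
  rw [h0]
  refine Eq.trans ?_ (lie_eq_chartMulHess v w).symm
  rw [chartMulHess_symm (w, 0), ← hw', ← hv']
  rfl

end AdjointDerivative
end EinsteinF4

/-! ### The Levi-Civita connection of a left-invariant metric -/

namespace EinsteinF4
section LeviCivita
open VectorField

/-- For a product `U` on a Lie algebra, the endomorphism
`v ↦ U v (U y z) - U y (U v z) - U ⁅v, y⁆ z`, whose trace is the Ricci curvature at `(y, z)` of the
left-invariant connection with product `U`. -/
def curvatureEnd {L : Type*} [LieRing L] [LieAlgebra ℝ L] (U : L →ₗ[ℝ] L →ₗ[ℝ] L) (y z : L) :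
    Module.End ℝ L :=
  U.flip (U y z) - U y * U.flip z + U.flip z * LieAlgebra.ad ℝ L y

/-- The Koszul formula characterizing the Levi-Civita product of an inner product `q` on a Lie
algebra. -/
def IsKoszulProduct {L : Type*} [LieRing L] [LieAlgebra ℝ L] (q : LinearMap.BilinForm ℝ L)
    (U : L →ₗ[ℝ] L →ₗ[ℝ] L) : Prop :=
  ∀ x y z, 2 * q (U x y) z = q ⁅x, y⁆ z - q ⁅y, z⁆ x + q ⁅z, x⁆ y

variable {n : ℕ} {G : Type*} [TopologicalSpace G] [ChartedSpace (EuclideanSpace ℝ (Fin n)) G]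
  [Group G]

lemma toLieAlgebra_sub (p : G) (v w : TangentSpace (𝓡 n) p) :
    toLieAlgebra p (v - w) = toLieAlgebra p v - toLieAlgebra p w :=
  map_sub (mfderiv (𝓡 n) (𝓡 n) (fun a : G => p⁻¹ * a) p) v w

variable [LieGroup (𝓡 n) (minSmoothness ℝ 3) G]

lemma toLieAlgebra_mulInvariantVectorField (x : GroupLieAlgebra (𝓡 n) G) (p : G) :
    toLieAlgebra p (mulInvariantVectorField x p) = x := by
  have h1 : HasMFDerivAt (𝓡 n) (𝓡 n) ((fun a : G => p⁻¹ * a) ∘ fun a => p * a) 1 _ :=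
    HasMFDerivAt.comp (1 : G) (g' := mfderiv (𝓡 n) (𝓡 n) (fun a : G => p⁻¹ * a) p)
      (by rw [mul_one]; exact mdifferentiableAt_mul_left.hasMFDerivAt)
      (mdifferentiableAt_mul_left (n := n) (g := p)).hasMFDerivAt
  have h2 := (hasMFDerivAt_id (I := 𝓡 n) (1 : G)).congr_of_eventuallyEq
    (f₁ := (fun a : G => p⁻¹ * a) ∘ fun a => p * a)
    (Filter.Eventually.of_forall fun x => by simp)
  exact DFunLike.congr_fun (hasMFDerivAt_unique h1 h2) x

lemma mulInvariantVectorField_toLieAlgebra (p : G) (v : TangentSpace (𝓡 n) p) :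
    mulInvariantVectorField (toLieAlgebra p v) p = v := by
  have h1 : HasMFDerivAt (𝓡 n) (𝓡 n) ((fun a : G => p * a) ∘ fun a => p⁻¹ * a) p _ :=
    HasMFDerivAt.comp (p : G) (g' := mfderiv (𝓡 n) (𝓡 n) (fun a : G => p * a) 1)
      (by rw [inv_mul_cancel]; exact mdifferentiableAt_mul_left.hasMFDerivAt)
      (mdifferentiableAt_mul_left (n := n) (g := p⁻¹)).hasMFDerivAt
  have h2 := (hasMFDerivAt_id (I := 𝓡 n) p).congr_of_eventuallyEq
    (f₁ := (fun a : G => p * a) ∘ fun a => p⁻¹ * a)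
    (Filter.Eventually.of_forall fun x => by simp)
  exact DFunLike.congr_fun (hasMFDerivAt_unique h1 h2) v

lemma leftInvariantMetric_mulInvariantVectorField
    (q : LinearMap.BilinForm ℝ (GroupLieAlgebra (𝓡 n) G)) (x y : GroupLieAlgebra (𝓡 n) G) (p : G) :
    leftInvariantMetric q p (mulInvariantVectorField x p) (mulInvariantVectorField y p) = q x y := by
  rw [leftInvariantMetric, toLieAlgebra_mulInvariantVectorField,
    toLieAlgebra_mulInvariantVectorField]

variable {q : LinearMap.BilinForm ℝ (GroupLieAlgebra (𝓡 n) G)}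
  {nabla : CovariantDerivative (𝓡 n) (EuclideanSpace ℝ (Fin n))
    (TangentSpace (𝓡 n) : G → Type _)}

/-- The Levi-Civita connection of a left-invariant metric is given on left-invariant vector fields
by the Koszul product on the Lie algebra. -/
lemma IsLeviCivita.apply_mulInvariantVectorField (hq : IsInnerProduct q)
    (hn : IsLeviCivita (leftInvariantMetric q) nabla)
    {U : GroupLieAlgebra (𝓡 n) G →ₗ[ℝ] GroupLieAlgebra (𝓡 n) G →ₗ[ℝ] GroupLieAlgebra (𝓡 n) G}
    (hU : IsKoszulProduct q U) (x y : GroupLieAlgebra (𝓡 n) G) (p : G) :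
    nabla (mulInvariantVectorField y) p (mulInvariantVectorField x p) =
      mulInvariantVectorField (U x y) p := by
  set N : GroupLieAlgebra (𝓡 n) G → GroupLieAlgebra (𝓡 n) G → GroupLieAlgebra (𝓡 n) G :=
    fun x y => toLieAlgebra p (nabla (mulInvariantVectorField y) p (mulInvariantVectorField x p))
    with hN
  have htor : ∀ x y, N x y - N y x = ⁅x, y⁆ := by
    intro x y
    have h := hn.torsion_free (mulInvariantVectorField x) (mulInvariantVectorField y) p
      (mdifferentiableAt_mulInvariantVectorField x) (mdifferentiableAt_mulInvariantVectorField y)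
    rw [← mulInvariantVector_mlieBracket, ← GroupLieAlgebra.bracket_def] at h
    have h2 := congrArg (toLieAlgebra p) h
    rw [toLieAlgebra_sub, toLieAlgebra_mulInvariantVectorField] at h2
    exact h2
  have hcomp : ∀ x y z, q (N z x) y + q x (N z y) = 0 := by
    intro x y z
    have h := hn.compatible (mulInvariantVectorField x) (mulInvariantVectorField y) p
      (mulInvariantVectorField z p)
      (mdifferentiableAt_mulInvariantVectorField x) (mdifferentiableAt_mulInvariantVectorField y)
    have hconst : (fun a : G => leftInvariantMetric q a (mulInvariantVectorField x a)
        (mulInvariantVectorField y a)) = fun _ => q x y :=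
      funext (leftInvariantMetric_mulInvariantVectorField q x y)
    rw [hconst] at h
    have h0 : mvfderiv (𝓡 n) (fun _ : G => q x y) p (mulInvariantVectorField z p) = 0 := by
      simp [mvfderiv]
    rw [h0] at h
    simp only [leftInvariantMetric, toLieAlgebra_mulInvariantVectorField] at h
    exact h.symm
  have hkos : ∀ z, q (N x y) z = q (U x y) z := by
    intro z
    have h := hU x y z
    rw [← htor x y, ← htor y z, ← htor z x] at h
    simp only [map_sub, LinearMap.sub_apply] at h
    have h1 := hcomp y z x
    have h2 := hcomp z x y
    have h3 := hcomp x y z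
    have s1 := hq.symm y (N x z)
    have s2 := hq.symm z (N y x)
    have s3 := hq.symm x (N z y)
    linarith
  have hNU : N x y = U x y := by
    by_contra hne
    have h := hq.pos (N x y - U x y) (sub_ne_zero.2 hne)
    rw [LinearMap.map_sub₂, hkos, sub_self] at h
    exact lt_irrefl _ h
  rw [← hNU]
  exact (mulInvariantVectorField_toLieAlgebra p _).symm

/-- The Ricci curvature of a left-invariant metric is the trace of the curvature endomorphism of its
Koszul product. -/
lemma IsLeviCivita.ricci_mulInvariantVectorField (hq : IsInnerProduct q)
    (hn : IsLeviCivita (leftInvariantMetric q) nabla)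
    {U : GroupLieAlgebra (𝓡 n) G →ₗ[ℝ] GroupLieAlgebra (𝓡 n) G →ₗ[ℝ] GroupLieAlgebra (𝓡 n) G}
    (hU : IsKoszulProduct q U) (y z : GroupLieAlgebra (𝓡 n) G) (p : G) :
    ricci nabla (mulInvariantVectorField y) (mulInvariantVectorField z) p =
      LinearMap.trace ℝ _ (curvatureEnd U y z) := by
  have hfun : ∀ x y, (fun a => nabla (mulInvariantVectorField y) a (mulInvariantVectorField x a)) =
      mulInvariantVectorField (U x y) :=
    fun x y => funext (hn.apply_mulInvariantVectorField hq hU x y)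
  have hcurv : ∀ x, toLieAlgebra p (curvature nabla (mulInvariantVectorField x)
      (mulInvariantVectorField y) (mulInvariantVectorField z) p) = curvatureEnd U y z x := by
    intro x
    rw [curvature, hfun, hfun, ← mulInvariantVector_mlieBracket, ← GroupLieAlgebra.bracket_def,
      hn.apply_mulInvariantVectorField hq hU, hn.apply_mulInvariantVectorField hq hU,
      hn.apply_mulInvariantVectorField hq hU, toLieAlgebra_sub, toLieAlgebra_sub,
      toLieAlgebra_mulInvariantVectorField, toLieAlgebra_mulInvariantVectorField,
      toLieAlgebra_mulInvariantVectorField, ← lie_skew x y, map_neg]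
    simp [curvatureEnd]
  rw [ricci, LinearMap.trace_eq_matrix_trace ℝ (Module.finBasis ℝ (GroupLieAlgebra (𝓡 n) G)),
    Matrix.trace]
  refine Finset.sum_congr rfl fun i _ => ?_
  rw [hcurv, Matrix.diag_apply, LinearMap.toMatrix_apply]
  rfl

end LeviCivita
end EinsteinF4

/-! ### Gradings with spin components and partial Killing forms -/

namespace EinsteinF4
section SpinGrading

/-- The family `P` consists of the projections of a grading of the Lie algebra `L` by the Klein
four-group; the group is encoded as `Fin 4` with bitwise exclusive or. -/
structure IsKleinGrading {K L : Type*} [CommRing K] [LieRing L] [LieAlgebra K L]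
    (P : Fin 4 → Module.End K L) : Prop where
  apply_apply : ∀ i j x, P i (P j x) = if i = j then P i x else 0
  sum_apply : ∀ x, ∑ i, P i x = x
  apply_lie : ∀ i j x y, P (i ^^^ j) ⁅P i x, P j y⁆ = ⁅P i x, P j y⁆

variable {L : Type*} [LieRing L] [LieAlgebra ℝ L]

/-- A Klein grading of a Lie algebra with the features of the grading of the compact Lie algebra of
type `F₄` by `𝔰𝔬(8)` and its three eight-dimensional representations: Schur's lemma holds for the
action of the neutral component, and some neutral element `T` has `ad T` traces in the ratio
`6 : 1 : 1 : 1`. -/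
structure IsSpinGrading (P : Fin 4 → Module.End ℝ L) : Prop extends IsKleinGrading P where
  schur : ∀ A : Module.End ℝ L, (∀ x y, A ⁅P 0 x, y⁆ = ⁅P 0 x, A y⁆) →
    ∀ i, ∃ c : ℝ, ∀ x, A (P i x) = c • P i x
  trace_zero : LinearMap.trace ℝ L (P 0) = 28
  trace_ne_zero : ∀ i ≠ 0, LinearMap.trace ℝ L (P i) = 8
  exists_neutral : ∃ T, P 0 T = T ∧ ∃ c : ℝ, c ≠ 0 ∧
    LinearMap.trace ℝ L (LieAlgebra.ad ℝ L T * LieAlgebra.ad ℝ L T * P 0) = 6 * c ∧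
    ∀ i ≠ 0, LinearMap.trace ℝ L (LieAlgebra.ad ℝ L T * LieAlgebra.ad ℝ L T * P i) = c

/-- The partial Killing form `(y, z) ↦ tr (ad y ∘ ad z ∘ P k)`. -/
noncomputable def partialKilling (P : Fin 4 → Module.End ℝ L) (k : Fin 4) :
    LinearMap.BilinForm ℝ L :=
  LinearMap.mk₂ ℝ (fun y z =>
    LinearMap.trace ℝ L (LieAlgebra.ad ℝ L y * LieAlgebra.ad ℝ L z * P k))
    (by intro a b c; simp [add_mul]) (by intro a b c; simp)
    (by intro a b c; simp [add_mul, mul_add]) (by intro a b c; simp)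

lemma partialKilling_apply (P : Fin 4 → Module.End ℝ L) (k : Fin 4) (y z : L) :
    partialKilling P k y z =
      LinearMap.trace ℝ L (LieAlgebra.ad ℝ L y * LieAlgebra.ad ℝ L z * P k) := rfl

namespace IsKleinGrading

variable {P : Fin 4 → Module.End ℝ L} (hP : IsKleinGrading P)
include hP

lemma apply_self (i : Fin 4) (x : L) : P i (P i x) = P i x := by simp [hP.apply_apply]

lemma apply_of_ne {i j : Fin 4} (h : i ≠ j) (x : L) : P i (P j x) = 0 := by
  simp [hP.apply_apply, h]

lemma lie_apply (i k : Fin 4) (x y : L) : ⁅P i x, P k y⁆ = P (i ^^^ k) ⁅P i x, y⁆ := by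
  conv_rhs => rw [← hP.sum_apply y]
  rw [lie_sum, map_sum, Finset.sum_eq_single k]
  · rw [hP.apply_lie]
  · intro j _ hj
    rw [← hP.apply_lie i j, hP.apply_of_ne]
    revert i j k; decide
  · simp

lemma neutral_lie (x y : L) (k : Fin 4) : ⁅P 0 x, P k y⁆ = P k ⁅P 0 x, y⁆ := by
  have h0 : (0 : Fin 4) ^^^ k = k := by revert k; decide
  rw [hP.lie_apply, h0]

lemma ad_mul (i k : Fin 4) (x : L) :
    LieAlgebra.ad ℝ L (P i x) * P k = P (i ^^^ k) * LieAlgebra.ad ℝ L (P i x) := by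
  ext y
  simpa using hP.lie_apply i k x y

lemma sum_eq_one : ∑ i, P i = 1 := by
  ext x
  simpa using hP.sum_apply x

lemma partialKilling_lie (k : Fin 4) (x y z : L) :
    partialKilling P k ⁅P 0 x, y⁆ z = - partialKilling P k y ⁅P 0 x, z⁆ := by
  have hc : LieAlgebra.ad ℝ L (P 0 x) * P k = P k * LieAlgebra.ad ℝ L (P 0 x) := by
    ext w
    simpa using hP.neutral_lie x w k
  set X := LieAlgebra.ad ℝ L (P 0 x)
  have hb : ∀ w, LieAlgebra.ad ℝ L ⁅P 0 x, w⁆ =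
      X * LieAlgebra.ad ℝ L w - LieAlgebra.ad ℝ L w * X := by
    intro w; ext v; simp [X]
  rw [partialKilling_apply, partialKilling_apply, hb, hb]
  set Y := LieAlgebra.ad ℝ L y
  set Z := LieAlgebra.ad ℝ L z
  have h1 : LinearMap.trace ℝ L (X * (Y * Z * P k)) = LinearMap.trace ℝ L (Y * Z * (X * P k)) := by
    rw [LinearMap.trace_mul_comm, hc, mul_assoc (Y * Z)]
  rw [eq_neg_iff_add_eq_zero, ← map_add]
  have h2 : (X * Y - Y * X) * Z * P k + Y * (X * Z - Z * X) * P k =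
      X * (Y * Z * P k) - Y * Z * (X * P k) := by noncomm_ring
  rw [h2, map_sub, h1, sub_self]

lemma partialKilling_apply_swap (i k : Fin 4) (y z : L) :
    partialKilling P k (P i y) (P i z) = partialKilling P (i ^^^ k) (P i z) (P i y) := by
  rw [partialKilling_apply, partialKilling_apply, mul_assoc, hP.ad_mul, ← mul_assoc,
    LinearMap.trace_mul_comm, ← mul_assoc]

lemma sum_partialKilling (x y : L) :
    ∑ k, partialKilling P k x y =
      LinearMap.trace ℝ L (LieAlgebra.ad ℝ L x * LieAlgebra.ad ℝ L y) := by
  simp only [partialKilling_apply]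
  rw [← map_sum, ← Finset.mul_sum, hP.sum_eq_one, mul_one]

lemma sum_partialKilling_lie (x y z : L) :
    ∑ k, partialKilling P k ⁅x, y⁆ z = ∑ k, partialKilling P k x ⁅y, z⁆ := by
  rw [hP.sum_partialKilling, hP.sum_partialKilling]
  have hb : ∀ v w, LieAlgebra.ad ℝ L ⁅v, w⁆ = LieAlgebra.ad ℝ L v * LieAlgebra.ad ℝ L w -
      LieAlgebra.ad ℝ L w * LieAlgebra.ad ℝ L v := by
    intro v w; ext u; simp
  rw [hb, hb, sub_mul, mul_sub, map_sub, map_sub, mul_assoc, mul_assoc, ← mul_assoc _ _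
    (LieAlgebra.ad ℝ L y), LinearMap.trace_mul_comm ℝ (LieAlgebra.ad ℝ L y)]

end IsKleinGrading

namespace IsInnerProduct

variable {B : LinearMap.BilinForm ℝ L} (hB : IsInnerProduct B)
include hB

lemma eq_zero {x : L} (h : B x x = 0) : x = 0 := by
  by_contra hx
  exact (hB.pos x hx).ne' h

lemma nondegenerate : B.Nondegenerate := by
  refine ⟨fun x hx => hB.eq_zero (hx x), fun x hx => hB.eq_zero (hx x)⟩

lemma exists_endomorphism [Module.Finite ℝ L] (q : LinearMap.BilinForm ℝ L) :
    ∃ A : Module.End ℝ L, ∀ x y, B (A x) y = q x y := by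
  refine ⟨(LinearMap.BilinForm.toDual B hB.nondegenerate).symm.toLinearMap ∘ₗ q, fun x y => ?_⟩
  rw [← LinearMap.BilinForm.toDual_def hB.nondegenerate]
  simp

lemma ext {x y : L} (h : ∀ z, B x z = B y z) : x = y := by
  refine sub_eq_zero.1 (hB.eq_zero ?_)
  rw [LinearMap.map_sub₂, h, sub_self]

end IsInnerProduct

/-- Both sides are the sum of `-B(⁅e, f⁆, ⁅e, f⁆)` over orthonormal bases `e` of the `i`-th and `f` of
the `k`-th component; the proof uses a basis of `L` and its `B`-dual instead. -/
lemma IsAssociativeInnerProduct.mul_trace_comm [Module.Finite ℝ L] {P : Fin 4 → Module.End ℝ L}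
    {B : LinearMap.BilinForm ℝ L} (hB : IsAssociativeInnerProduct B) {l : Fin 4 → Fin 4 → ℝ}
    (hl : ∀ i k y z, partialKilling P k (P i y) z = l i k * B (P i y) z) (i k : Fin 4) :
    l i k * LinearMap.trace ℝ L (P i) = l k i * LinearMap.trace ℝ L (P k) := by
  classical
  set b := Module.finBasis ℝ L
  set d := LinearMap.BilinForm.dualBasis B hB.toIsInnerProduct.nondegenerate b
  have htr : ∀ M : Module.End ℝ L, LinearMap.trace ℝ L M = ∑ a, B (d a) (M (b a)) := by
    intro M
    rw [LinearMap.trace_eq_matrix_trace ℝ b, Matrix.trace]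
    refine Finset.sum_congr rfl fun a _ => ?_
    rw [Matrix.diag_apply, LinearMap.toMatrix_apply]
    conv_rhs => rw [← b.sum_repr (M (b a))]
    simp only [map_sum, map_smul, d, LinearMap.BilinForm.apply_dualBasis_left, smul_eq_mul,
      mul_ite, mul_one, mul_zero, Finset.sum_ite_eq', Finset.mem_univ, if_true]
  have key : ∀ i k, l i k * LinearMap.trace ℝ L (P i) =
      - ∑ a, ∑ c, B ⁅P i (b a), d c⁆ ⁅d a, P k (b c)⁆ := by
    intro i k
    rw [htr, Finset.mul_sum, ← Finset.sum_neg_distrib]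
    refine Finset.sum_congr rfl fun a _ => ?_
    rw [hB.symm, ← hl, partialKilling_apply, htr, ← Finset.sum_neg_distrib]
    refine Finset.sum_congr rfl fun c _ => ?_
    rw [Module.End.mul_apply, Module.End.mul_apply, LieAlgebra.ad_apply, LieAlgebra.ad_apply,
      ← hB.assoc, ← lie_skew, map_neg, LinearMap.neg_apply]
  rw [key, key, Finset.sum_comm]
  refine congrArg _ (Finset.sum_congr rfl fun c _ => Finset.sum_congr rfl fun a _ => ?_)
  rw [hB.symm, ← lie_skew (d a) (P k (b c)), ← lie_skew (P i (b a)) (d c)]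
  simp only [map_neg, LinearMap.neg_apply, neg_neg]

namespace IsSpinGrading

variable {P : Fin 4 → Module.End ℝ L} (hP : IsSpinGrading P)
  {B : LinearMap.BilinForm ℝ L} (hB : IsAssociativeInnerProduct B)
include hP

lemma exists_apply_ne_zero (i : Fin 4) : ∃ x, P i x ≠ 0 := by
  by_contra! h
  have h0 : P i = 0 := by ext x; exact h x
  by_cases hi : i = 0
  · have := hP.trace_zero
    rw [← hi, h0, map_zero] at this
    norm_num at this
  · have := hP.trace_ne_zero i hi
    rw [h0, map_zero] at this
    norm_num at this

variable [Module.Finite ℝ L]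
include hB

/-- Schur's lemma for bilinear forms: a form invariant under the neutral component is a multiple of
`B` on each component. -/
lemma exists_eq_smul_of_invariant (q : LinearMap.BilinForm ℝ L)
    (hq : ∀ x y z, q ⁅P 0 x, y⁆ z = - q y ⁅P 0 x, z⁆) (i : Fin 4) :
    ∃ c : ℝ, ∀ x y, q (P i x) y = c * B (P i x) y := by
  obtain ⟨A, hA⟩ := hB.toIsInnerProduct.exists_endomorphism q
  obtain ⟨c, hc⟩ := hP.schur A (fun x y => hB.toIsInnerProduct.ext fun z => by
    rw [hA, hq, ← hA, ← lie_skew (P 0 x) (A y), map_neg, LinearMap.neg_apply, hB.assoc]) i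
  refine ⟨c, fun x y => ?_⟩
  rw [← hA, hc, map_smul, LinearMap.smul_apply, smul_eq_mul]

lemma inner_apply_apply_of_ne {i j : Fin 4} (h : i ≠ j) (x y : L) : B (P i x) (P j y) = 0 := by
  obtain ⟨c, hc⟩ := hP.exists_eq_smul_of_invariant hB (B.compl₂ (P j)) (by
    intro x y z
    rw [LinearMap.compl₂_apply, LinearMap.compl₂_apply, ← hP.neutral_lie, ← hB.assoc,
      ← lie_skew y, map_neg, LinearMap.neg_apply, neg_neg]) i
  simp only [LinearMap.compl₂_apply] at hc
  have h1 := hc x (P i x)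
  rw [hP.apply_of_ne h.symm, map_zero] at h1
  rw [hc]
  rcases mul_eq_zero.1 h1.symm with h2 | h2
  · rw [h2, zero_mul]
  · rw [hB.eq_zero h2]; simp

lemma inner_apply_left (i : Fin 4) (x y : L) : B (P i x) y = B (P i x) (P i y) := by
  conv_lhs => rw [← hP.sum_apply y]
  rw [map_sum, Finset.sum_eq_single i]
  · intro j _ hj; exact hP.inner_apply_apply_of_ne hB hj.symm _ _
  · simp

lemma inner_apply_comm (i : Fin 4) (x y : L) : B (P i x) y = B x (P i y) := by
  rw [hP.inner_apply_left hB, hB.symm x, hP.inner_apply_left hB i y x, hB.symm]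

lemma exists_partialKilling_eq : ∃ l : Fin 4 → Fin 4 → ℝ, ∀ i k y z,
    partialKilling P k (P i y) z = l i k * B (P i y) z := by
  have h := fun i k => hP.exists_eq_smul_of_invariant hB (partialKilling P k)
    (hP.partialKilling_lie k) i
  choose l hl using h
  exact ⟨l, hl⟩

/-- The partial Killing forms are determined by the traces of the grading: the factor `a` is common
to all of them. -/
theorem exists_partialKilling_table : ∃ a : ℝ, a ≠ 0 ∧ ∃ l : Fin 4 → Fin 4 → ℝ,
    (∀ i k y z, partialKilling P k (P i y) z = l i k * B (P i y) z) ∧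
    l 0 0 = 6 * a ∧ (∀ k ≠ 0, l 0 k = a) ∧
    ∀ i ≠ 0, l i 0 = 7 * a / 2 ∧ l i i = 7 * a / 2 ∧ ∀ k ≠ 0, k ≠ i → l i k = a := by
  obtain ⟨l, hl⟩ := hP.exists_partialKilling_eq hB
  obtain ⟨T, hT, c, hc, h0, hk⟩ := hP.exists_neutral
  have hl0 : ∀ k, LinearMap.trace ℝ L (LieAlgebra.ad ℝ L T * LieAlgebra.ad ℝ L T * P k) =
      l 0 k * B T T := fun k => by
    have := hl 0 k T T
    rwa [hT, partialKilling_apply] at this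
  have hb : B T T ≠ 0 := by
    intro h
    have := hl0 0
    rw [h, h0, mul_zero] at this
    exact hc (by linarith)
  have h00 : l 0 0 = 6 * (c / B T T) := by
    have := hl0 0
    rw [h0] at this
    field_simp
    linarith
  have h0k : ∀ k ≠ 0, l 0 k = c / B T T := fun k hk0 => by
    have := hl0 k
    rw [hk k hk0] at this
    field_simp
    linarith
  -- the dimensions of the components enter here, as `28 = 7 / 2 * 8`
  have hi0 : ∀ i ≠ 0, l i 0 = 7 * (c / B T T) / 2 := fun i hi => by
    have := hB.mul_trace_comm hl i 0
    rw [hP.trace_zero, hP.trace_ne_zero i hi, h0k i hi] at this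
    linarith
  -- on the `i`-th component, the partial Killing forms for `k` and `i ^^^ k` agree
  have hswap : ∀ i k, l i k = l i (i ^^^ k) := fun i k => by
    obtain ⟨x, hx⟩ := hP.exists_apply_ne_zero i
    have h := hP.partialKilling_apply_swap i k x x
    rw [hl, hl] at h
    exact mul_right_cancel₀ (hB.pos _ hx).ne' h
  -- the Killing form is associative, so it is the same multiple of `B` on components that are
  -- joined by a nonzero bracket
  have htot : ∀ i ≠ 0, ∑ k, l i k = ∑ k, l 0 k := fun i hi => by
    obtain ⟨y, hy⟩ : ∃ y, ⁅T, P i y⁆ ≠ 0 := by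
      by_contra! h
      have h1 : LieAlgebra.ad ℝ L T * P i = 0 := by ext y; simpa using h y
      have h2 := hk i hi
      rw [mul_assoc, h1, mul_zero, map_zero] at h2
      exact hc h2.symm
    have h1 := hP.sum_partialKilling_lie T (P i y) ⁅T, P i y⁆
    have h2 : ⁅T, P i y⁆ = P i ⁅T, y⁆ := by
      have := hP.neutral_lie T y i
      rwa [hT] at this
    have h3 : ∀ k z, partialKilling P k ⁅T, P i y⁆ z = l i k * B ⁅T, P i y⁆ z := fun k z => by
      rw [h2, hl]
    have h4 : ∀ k z, partialKilling P k T z = l 0 k * B T z := fun k z => by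
      have := hl 0 k T z
      rwa [hT] at this
    simp only [h3, h4] at h1
    rw [← Finset.sum_mul, ← Finset.sum_mul, hB.assoc T] at h1
    refine mul_right_cancel₀ ?_ h1
    rw [← hB.assoc]
    exact (hB.pos _ hy).ne'
  refine ⟨c / B T T, div_ne_zero hc hb, l, hl, h00, h0k, fun i hi => ?_⟩
  have hii : l i i = 7 * (c / B T T) / 2 := by
    rw [hswap, ← hi0 i hi]
    congr 1
    revert i; decide
  refine ⟨hi0 i hi, hii, fun k hk0 hki => ?_⟩
  have h1 := htot i hi
  have h2 := hswap i k
  have h3 := hi0 i hi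
  rw [Fin.sum_univ_four, Fin.sum_univ_four, h00, h0k 1 (by decide), h0k 2 (by decide),
    h0k 3 (by decide)] at h1
  fin_cases i <;> fin_cases k <;> first | contradiction | skip
  all_goals
    simp at h1 h2 h3 hii ⊢
    linarith

end IsSpinGrading
end SpinGrading
end EinsteinF4

/-! ### The Ricci curvature of a block metric -/

namespace EinsteinF4
section BlockMetric

variable {L : Type*} [LieRing L] [LieAlgebra ℝ L]

/-- The factor `c` such that the Koszul product of the block metric with coefficients `u` is
`c ⁅x, y⁆` for `x` in the `i`-th and `y` in the `j`-th component. -/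
noncomputable def koszulCoeff (u : Fin 4 → ℝ) (i j : Fin 4) : ℝ :=
  (1 + (u j - u i) * (u (i ^^^ j))⁻¹) / 2

/-- The Koszul product of the block metric with coefficients `u`. -/
noncomputable def blockKoszulProduct (P : Fin 4 → Module.End ℝ L) (u : Fin 4 → ℝ) :
    L →ₗ[ℝ] L →ₗ[ℝ] L :=
  (2⁻¹ : ℝ) • ((LieAlgebra.ad ℝ L : L →ₗ[ℝ] L →ₗ[ℝ] L) +
    ((LieAlgebra.ad ℝ L : L →ₗ[ℝ] L →ₗ[ℝ] L).compl₂ (∑ i, u i • P i) -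
      (LieAlgebra.ad ℝ L : L →ₗ[ℝ] L →ₗ[ℝ] L) ∘ₗ (∑ i, u i • P i)).compr₂
        (∑ i, (u i)⁻¹ • P i))

lemma blockKoszulProduct_apply (P : Fin 4 → Module.End ℝ L) (u : Fin 4 → ℝ) (x y : L) :
    blockKoszulProduct P u x y = (2⁻¹ : ℝ) • (⁅x, y⁆ + (∑ i, (u i)⁻¹ • P i)
      (⁅x, (∑ i, u i • P i) y⁆ - ⁅(∑ i, u i • P i) x, y⁆)) := by
  rw [blockKoszulProduct]
  generalize ∑ i, u i • P i = A
  generalize ∑ i, (u i)⁻¹ • P i = A'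
  simp

namespace IsKleinGrading

variable {P : Fin 4 → Module.End ℝ L} (hP : IsKleinGrading P)
include hP

lemma sum_smul_apply (u : Fin 4 → ℝ) (i : Fin 4) (x : L) :
    (∑ j, u j • P j) (P i x) = u i • P i x := by
  rw [LinearMap.sum_apply, Finset.sum_eq_single i]
  · rw [LinearMap.smul_apply, hP.apply_self]
  · intro j _ hj; rw [LinearMap.smul_apply, hP.apply_of_ne hj, smul_zero]
  · simp

lemma blockKoszulProduct_apply_apply (u : Fin 4 → ℝ) (i j : Fin 4) (x y : L) :
    blockKoszulProduct P u (P i x) (P j y) = koszulCoeff u i j • ⁅P i x, P j y⁆ := by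
  rw [blockKoszulProduct_apply, hP.sum_smul_apply, hP.sum_smul_apply, lie_smul, smul_lie,
    ← sub_smul, map_smul, ← hP.apply_lie i j, hP.sum_smul_apply, koszulCoeff]
  module

/-- The component of the curvature endomorphism that contributes to the `k`-th part of the trace. -/
lemma curvatureEnd_mul (u : Fin 4 → ℝ) (i j k : Fin 4) (y z : L) :
    curvatureEnd (blockKoszulProduct P u) (P i y) (P j z) * P k =
      (koszulCoeff u k j * koszulCoeff u i (k ^^^ j) - koszulCoeff u i j * koszulCoeff u k (i ^^^ j)) •
        (LieAlgebra.ad ℝ L (P i y) * LieAlgebra.ad ℝ L (P j z) * P k) +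
      (koszulCoeff u i j * koszulCoeff u k (i ^^^ j) - koszulCoeff u (i ^^^ k) j) •
        (LieAlgebra.ad ℝ L (P j z) * LieAlgebra.ad ℝ L (P i y) * P k) := by
  ext v
  have h1 : blockKoszulProduct P u (P k v) (blockKoszulProduct P u (P i y) (P j z)) =
      (koszulCoeff u i j * koszulCoeff u k (i ^^^ j)) • ⁅P k v, ⁅P i y, P j z⁆⁆ := by
    rw [hP.blockKoszulProduct_apply_apply, map_smul, ← hP.apply_lie i j,
      hP.blockKoszulProduct_apply_apply, smul_smul]
  have h2 : blockKoszulProduct P u (P i y) (blockKoszulProduct P u (P k v) (P j z)) =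
      (koszulCoeff u k j * koszulCoeff u i (k ^^^ j)) • ⁅P i y, ⁅P k v, P j z⁆⁆ := by
    rw [hP.blockKoszulProduct_apply_apply, map_smul, ← hP.apply_lie k j,
      hP.blockKoszulProduct_apply_apply, smul_smul]
  have h3 : blockKoszulProduct P u ⁅P i y, P k v⁆ (P j z) =
      koszulCoeff u (i ^^^ k) j • ⁅⁅P i y, P k v⁆, P j z⁆ := by
    rw [← hP.apply_lie i k, hP.blockKoszulProduct_apply_apply]
  have e1 : ⁅P k v, ⁅P i y, P j z⁆⁆ = ⁅P j z, ⁅P i y, P k v⁆⁆ - ⁅P i y, ⁅P j z, P k v⁆⁆ := by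
    rw [← lie_skew, lie_lie]; abel
  have e2 : ⁅P i y, ⁅P k v, P j z⁆⁆ = - ⁅P i y, ⁅P j z, P k v⁆⁆ := by
    rw [← lie_skew (P k v), lie_neg]
  have e3 : ⁅⁅P i y, P k v⁆, P j z⁆ = - ⁅P j z, ⁅P i y, P k v⁆⁆ := by
    rw [← lie_skew]
  simp only [curvatureEnd, Module.End.mul_apply, LinearMap.add_apply, LinearMap.sub_apply,
    LinearMap.flip_apply, LieAlgebra.ad_apply, LinearMap.smul_apply, h1, h2, h3, e1, e2, e3]
  module

end IsKleinGrading

/-- The Ricci form of a product on a Lie algebra. -/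
noncomputable def ricciForm (U : L →ₗ[ℝ] L →ₗ[ℝ] L) : LinearMap.BilinForm ℝ L :=
  LinearMap.mk₂ ℝ (fun y z => LinearMap.trace ℝ L (curvatureEnd U y z))
    (by intro a b c; rw [← map_add]; congr 1; ext; simp [curvatureEnd]; abel)
    (by intro a b c; rw [← map_smul]; congr 1; ext; simp [curvatureEnd, smul_sub])
    (by intro a b c; rw [← map_add]; congr 1; ext; simp [curvatureEnd]; abel)
    (by intro a b c; rw [← map_smul]; congr 1; ext; simp [curvatureEnd, smul_sub])

lemma ricciForm_apply (U : L →ₗ[ℝ] L →ₗ[ℝ] L) (y z : L) :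
    ricciForm U y z = LinearMap.trace ℝ L (curvatureEnd U y z) := rfl

/-- The Ricci curvature of the block metric on the `i`-th component, as a multiple of `B`. -/
noncomputable def ricciCoeff (l : Fin 4 → Fin 4 → ℝ) (u : Fin 4 → ℝ) (i : Fin 4) : ℝ :=
  ∑ k, l i k * (koszulCoeff u k i * koszulCoeff u i (k ^^^ i) - koszulCoeff u (i ^^^ k) i)

namespace IsSpinGrading

variable {P : Fin 4 → Module.End ℝ L} (hP : IsSpinGrading P) [Module.Finite ℝ L]
  {B : LinearMap.BilinForm ℝ L} (hB : IsAssociativeInnerProduct B)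
include hP hB

lemma ricciForm_apply_apply {l : Fin 4 → Fin 4 → ℝ}
    (hl : ∀ i k y z, partialKilling P k (P i y) z = l i k * B (P i y) z) (u : Fin 4 → ℝ)
    (i j : Fin 4) (y z : L) :
    ricciForm (blockKoszulProduct P u) (P i y) (P j z) =
      ricciCoeff l u i * B (P i y) (P j z) := by
  have h1 : curvatureEnd (blockKoszulProduct P u) (P i y) (P j z) =
      ∑ k, curvatureEnd (blockKoszulProduct P u) (P i y) (P j z) * P k := by
    rw [← Finset.mul_sum, hP.sum_eq_one, mul_one]
  rw [ricciForm_apply, h1, map_sum, ricciCoeff, Finset.sum_mul]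
  refine Finset.sum_congr rfl fun k _ => ?_
  rw [hP.curvatureEnd_mul, map_add, map_smul, map_smul, ← partialKilling_apply,
    ← partialKilling_apply, hl, hl, hB.symm (P j z)]
  by_cases hij : i = j
  · subst hij
    simp only [smul_eq_mul]
    ring
  · rw [hP.inner_apply_apply_of_ne hB hij]
    simp

variable {h : Fin 4 → Submodule ℝ L} (hh : ∀ i x, x ∈ h i ↔ P i x = x) {u : Fin 4 → ℝ}
  (hu : ∀ i, 0 < u i) {q : LinearMap.BilinForm ℝ L} (hq : IsBlockSum h B u q)

include hh hq

lemma _root_.EinsteinF4.IsBlockSum.apply_eq (x y : L) : q x y = B ((∑ i, u i • P i) x) y := by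
  conv_lhs => rw [← hP.sum_apply x, ← hP.sum_apply y]
  simp only [map_sum, LinearMap.sum_apply, LinearMap.smul_apply, map_smul]
  rw [Finset.sum_comm]
  refine Finset.sum_congr rfl fun i _ => ?_
  rw [Finset.sum_eq_single i]
  · rw [hq i i _ ((hh i _).2 (hP.apply_self i x)) _ ((hh i _).2 (hP.apply_self i y)), if_pos rfl,
      hP.inner_apply_left hB i x y, smul_eq_mul]
  · intro j _ hj
    rw [hq i j _ ((hh i _).2 (hP.apply_self i x)) _ ((hh j _).2 (hP.apply_self j y)),
      if_neg (Ne.symm hj)]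
  · simp

lemma _root_.EinsteinF4.IsBlockSum.isInnerProduct (hu : ∀ i, 0 < u i) : IsInnerProduct q := by
  have key : ∀ x y, q x y = ∑ i, u i * B (P i x) (P i y) := by
    intro x y
    rw [hq.apply_eq hP hB hh]
    simp only [LinearMap.sum_apply, LinearMap.smul_apply, map_sum, map_smul, smul_eq_mul]
    exact Finset.sum_congr rfl fun i _ => by rw [hP.inner_apply_left hB]
  refine ⟨fun x y => ?_, fun x hx => ?_⟩
  · rw [key, key]
    exact Finset.sum_congr rfl fun i _ => by rw [hB.symm]
  · rw [key]
    obtain ⟨i, hi⟩ : ∃ i, P i x ≠ 0 := by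
      by_contra! h0
      exact hx (by rw [← hP.sum_apply x]; simp [h0])
    refine Finset.sum_pos' (fun j _ => mul_nonneg (hu j).le ?_)
      ⟨i, Finset.mem_univ i, mul_pos (hu i) (hB.pos _ hi)⟩
    by_cases hj : P j x = 0
    · simp [hj]
    · exact (hB.pos _ hj).le

include hu in
lemma isKoszulProduct_block : IsKoszulProduct q (blockKoszulProduct P u) := by
  intro x y z
  set A : Module.End ℝ L := ∑ i, u i • P i with hA
  have hAs : ∀ x y, B (A x) y = B x (A y) := by
    intro x y
    simp only [hA, LinearMap.sum_apply, LinearMap.smul_apply, map_sum, map_smul]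
    exact Finset.sum_congr rfl fun i _ => by rw [hP.inner_apply_comm hB]
  have hinv : ∀ x, A ((∑ i, (u i)⁻¹ • P i) x) = x := by
    intro x
    have h0 : (∑ i, (u i)⁻¹ • P i) x = ∑ i, (u i)⁻¹ • P i x := by simp
    rw [h0, map_sum]
    conv_rhs => rw [← hP.sum_apply x]
    refine Finset.sum_congr rfl fun i _ => ?_
    rw [map_smul, hA, hP.sum_smul_apply, smul_smul,
      inv_mul_cancel₀ (hu i).ne', one_smul]
  have hq' : ∀ x y, q x y = B (A x) y := hq.apply_eq hP hB hh
  have h2 : B ⁅z, x⁆ (A y) = B ⁅x, A y⁆ z := by rw [hB.assoc, hB.symm]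
  have h1 : B ⁅y, z⁆ (A x) = B ⁅A x, y⁆ z := by rw [hB.symm, hB.assoc]
  rw [hq', hq', hq', hq', hAs ⁅y, z⁆, hAs ⁅z, x⁆, h1, h2, blockKoszulProduct_apply, map_smul,
    map_add, hinv]
  simp only [map_smul, map_add, map_sub, LinearMap.smul_apply, LinearMap.add_apply,
    LinearMap.sub_apply, smul_eq_mul]
  ring

lemma exists_ricciForm_eq_iff {l : Fin 4 → Fin 4 → ℝ}
    (hl : ∀ i k y z, partialKilling P k (P i y) z = l i k * B (P i y) z) :
    (∃ c : ℝ, ∀ x y, ricciForm (blockKoszulProduct P u) x y = c * q x y) ↔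
      ∃ c : ℝ, ∀ i, ricciCoeff l u i = c * u i := by
  have hqP : ∀ i j x y, q (P i x) (P j y) = u i * B (P i x) (P j y) := by
    intro i j x y
    rw [hq.apply_eq hP hB hh, hP.sum_smul_apply, map_smul, LinearMap.smul_apply, smul_eq_mul]
  constructor
  · rintro ⟨c, hc⟩
    refine ⟨c, fun i => ?_⟩
    obtain ⟨x, hx⟩ := hP.exists_apply_ne_zero i
    have h1 := hc (P i x) (P i x)
    rw [hP.ricciForm_apply_apply hB hl, hqP, ← mul_assoc] at h1
    exact mul_right_cancel₀ (hB.pos _ hx).ne' h1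
  · rintro ⟨c, hc⟩
    refine ⟨c, fun x y => ?_⟩
    rw [← hP.sum_apply x, ← hP.sum_apply y]
    simp only [map_sum, LinearMap.sum_apply, Finset.mul_sum]
    refine Finset.sum_congr rfl fun i _ => Finset.sum_congr rfl fun j _ => ?_
    rw [hP.ricciForm_apply_apply hB hl, hqP, hc, mul_assoc]

end IsSpinGrading

/-- The Einstein equations of the block metric with coefficients `u₁, u₂, u₃, u₄`. -/
lemma exists_ricciCoeff_eq_iff {a : ℝ} (ha : a ≠ 0) {l : Fin 4 → Fin 4 → ℝ}
    (h00 : l 0 0 = 6 * a) (h0 : ∀ k ≠ 0, l 0 k = a)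
    (hi : ∀ i ≠ 0, l i 0 = 7 * a / 2 ∧ l i i = 7 * a / 2 ∧ ∀ k ≠ 0, k ≠ i → l i k = a)
    {u₁ u₂ u₃ u₄ : ℝ} (h₁ : 0 < u₁) (h₂ : 0 < u₂) (h₃ : 0 < u₃) (h₄ : 0 < u₄) :
    (∃ c : ℝ, ∀ i, ricciCoeff l ![u₁, u₂, u₃, u₄] i = c * ![u₁, u₂, u₃, u₄] i) ↔
      (-(3 / u₁) - u₁ / (2 * u₂ ^ 2) - u₁ / (2 * u₃ ^ 2) - u₁ / (2 * u₄ ^ 2)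
          = 7 * u₁ / (2 * u₂ ^ 2) - 9 / u₂
            + (u₃ ^ 2 + u₄ ^ 2 - u₂ ^ 2) / (u₂ * u₃ * u₄) ∧
        7 * u₁ / (2 * u₂ ^ 2) - 9 / u₂
            + (u₃ ^ 2 + u₄ ^ 2 - u₂ ^ 2) / (u₂ * u₃ * u₄)
          = 7 * u₁ / (2 * u₃ ^ 2) - 9 / u₃
            + (u₂ ^ 2 + u₄ ^ 2 - u₃ ^ 2) / (u₂ * u₃ * u₄) ∧
        7 * u₁ / (2 * u₃ ^ 2) - 9 / u₃
            + (u₂ ^ 2 + u₄ ^ 2 - u₃ ^ 2) / (u₂ * u₃ * u₄)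
          = 7 * u₁ / (2 * u₄ ^ 2) - 9 / u₄
            + (u₂ ^ 2 + u₃ ^ 2 - u₄ ^ 2) / (u₂ * u₃ * u₄)) := by
  obtain ⟨h10, h11, h1⟩ := hi 1 (by decide)
  obtain ⟨h20, h22, h2⟩ := hi 2 (by decide)
  obtain ⟨h30, h33, h3⟩ := hi 3 (by decide)
  have r0 : ricciCoeff l ![u₁, u₂, u₃, u₄] 0 = a / 2 *
      (-(3 / u₁) - u₁ / (2 * u₂ ^ 2) - u₁ / (2 * u₃ ^ 2) - u₁ / (2 * u₄ ^ 2)) * u₁ := by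
    simp only [ricciCoeff, Fin.sum_univ_four, h00, h0 1 (by decide), h0 2 (by decide),
      h0 3 (by decide), koszulCoeff]
    simp
    field_simp
    ring
  have r1 : ricciCoeff l ![u₁, u₂, u₃, u₄] 1 = a / 2 *
      (7 * u₁ / (2 * u₂ ^ 2) - 9 / u₂ + (u₃ ^ 2 + u₄ ^ 2 - u₂ ^ 2) / (u₂ * u₃ * u₄)) * u₂ := by
    simp only [ricciCoeff, Fin.sum_univ_four, h10, h11, h1 2 (by decide) (by decide),
      h1 3 (by decide) (by decide), koszulCoeff]
    simp
    field_simp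
    ring
  have r2 : ricciCoeff l ![u₁, u₂, u₃, u₄] 2 = a / 2 *
      (7 * u₁ / (2 * u₃ ^ 2) - 9 / u₃ + (u₂ ^ 2 + u₄ ^ 2 - u₃ ^ 2) / (u₂ * u₃ * u₄)) * u₃ := by
    simp only [ricciCoeff, Fin.sum_univ_four, h20, h22, h2 1 (by decide) (by decide),
      h2 3 (by decide) (by decide), koszulCoeff]
    simp
    field_simp
    ring
  have r3 : ricciCoeff l ![u₁, u₂, u₃, u₄] 3 = a / 2 *
      (7 * u₁ / (2 * u₄ ^ 2) - 9 / u₄ + (u₂ ^ 2 + u₃ ^ 2 - u₄ ^ 2) / (u₂ * u₃ * u₄)) * u₄ := by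
    simp only [ricciCoeff, Fin.sum_univ_four, h30, h33, h3 1 (by decide) (by decide),
      h3 2 (by decide) (by decide), koszulCoeff]
    simp
    field_simp
    ring
  have ha2 : a / 2 ≠ 0 := by simpa using ha
  constructor
  · rintro ⟨c, hc⟩
    have c0 := mul_right_cancel₀ h₁.ne' (r0.symm.trans (hc 0))
    have c1 := mul_right_cancel₀ h₂.ne' (r1.symm.trans (hc 1))
    have c2 := mul_right_cancel₀ h₃.ne' (r2.symm.trans (hc 2))
    have c3 := mul_right_cancel₀ h₄.ne' (r3.symm.trans (hc 3))
    exact ⟨mul_left_cancel₀ ha2 (c0.trans c1.symm), mul_left_cancel₀ ha2 (c1.trans c2.symm),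
      mul_left_cancel₀ ha2 (c2.trans c3.symm)⟩
  · rintro ⟨e1, e2, e3⟩
    refine ⟨a / 2 *
      (-(3 / u₁) - u₁ / (2 * u₂ ^ 2) - u₁ / (2 * u₃ ^ 2) - u₁ / (2 * u₄ ^ 2)), fun i => ?_⟩
    fin_cases i
    · exact r0
    · exact r1.trans (by rw [e1]; rfl)
    · exact r2.trans (by rw [e1, e2]; rfl)
    · exact r3.trans (by rw [e1, e2, e3]; rfl)

end BlockMetric
end EinsteinF4

/-! ### The roots of `F₄` in coordinates -/

namespace EinsteinF4
section RootsOfF4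

/-- The positive roots of `F₄`, in coordinates with respect to the simple roots. -/
def f4PositiveRoots : List (Fin 4 → ℤ) :=
  [![0, 0, 0, 1], ![0, 0, 1, 0], ![0, 1, 0, 0], ![1, 0, 0, 0], ![0, 0, 1, 1], ![0, 1, 1, 0],
    ![1, 1, 0, 0], ![0, 1, 1, 1], ![0, 1, 2, 0], ![1, 1, 1, 0], ![0, 1, 2, 1], ![1, 1, 1, 1],
    ![1, 1, 2, 0], ![0, 1, 2, 2], ![1, 1, 2, 1], ![1, 2, 2, 0], ![1, 1, 2, 2], ![1, 2, 2, 1],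
    ![1, 2, 2, 2], ![1, 2, 3, 1], ![1, 2, 3, 2], ![1, 2, 4, 2], ![1, 3, 4, 2], ![2, 3, 4, 2]]

/-- The roots of `F₄`, in coordinates with respect to the simple roots. -/
def f4Roots : List (Fin 4 → ℤ) := f4PositiveRoots ++ f4PositiveRoots.map fun a => -a

/-- The `j`-th simple reflection of `F₄` in coordinates. -/
def f4Reflect (j : Fin 4) (a : Fin 4 → ℤ) : Fin 4 → ℤ :=
  a - (∑ i, a i * CartanMatrix.F₄ i j) • Pi.single j 1

/-- The component of the Klein grading of `F₄` in which a root space lies, given by the parities of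
the last two coordinates. -/
def rootClass (a : Fin 4 → ℤ) : Fin 4 :=
  if Even (a 3) then if Even (a 2) then 0 else 1 else if Even (a 2) then 2 else 3

/-- The highest weight of each component of the Klein grading of `F₄`. -/
def topRoot : Fin 4 → Fin 4 → ℤ := ![![2, 3, 4, 2], ![1, 2, 3, 2], ![1, 2, 2, 1], ![1, 2, 3, 1]]

/-- The simple roots of the subsystem `D₄` of long roots of `F₄`. -/
def d4SimpleRoots : List (Fin 4 → ℤ) :=
  [![1, 0, 0, 0], ![0, 1, 0, 0], ![0, 1, 2, 0], ![0, 1, 2, 2]]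

set_option maxRecDepth 100000 in
lemma f4Roots_nodup : f4Roots.Nodup := by decide +kernel

lemma zero_notMem_f4Roots : 0 ∉ f4Roots := by decide +kernel

lemma neg_mem_f4Roots : ∀ a ∈ f4Roots, -a ∈ f4Roots := by decide +kernel

lemma single_mem_f4Roots : ∀ j, Pi.single j 1 ∈ f4Roots := by decide +kernel

lemma f4Reflect_mem_f4Roots : ∀ a ∈ f4Roots, ∀ j, f4Reflect j a ∈ f4Roots := by decide +kernel

lemma exists_f4Reflect_lt : ∀ a ∈ f4PositiveRoots, (∃ j, a = Pi.single j 1) ∨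
    ∃ j, f4Reflect j a ∈ f4PositiveRoots ∧ ∑ i, f4Reflect j a i < ∑ i, a i := by decide +kernel

lemma d4SimpleRoots_mem : ∀ b ∈ d4SimpleRoots, b ∈ f4Roots ∧ rootClass b = 0 := by decide +kernel

/-- Every root that is not the highest weight of its component of the Klein grading can be raised by
a simple root of `D₄`, or is the negative of one. -/
lemma exists_add_mem_f4Roots : ∀ a ∈ f4Roots, a = topRoot (rootClass a) ∨ ∃ b ∈ d4SimpleRoots,
    a = -b ∨ a + b ∈ f4Roots ∧ a + b + b ∉ f4Roots ∧ a + b + b ≠ 0 := by decide +kernel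

/-- Together with the four-dimensional Cartan subalgebra, these roots make the neutral component
28-dimensional. -/
lemma sum_rootClass_zero :
    (f4Roots.map fun a => if rootClass a = 0 then (1 : ℤ) else 0).sum = 24 := by
  decide +kernel

lemma sum_rootClass :
    ∀ i ≠ 0, (f4Roots.map fun a => if rootClass a = i then (1 : ℤ) else 0).sum = 8 := by
  decide +kernel

/-- Up to the factor `-π ^ 2`, this sum and those of `sum_sq_rootClass` are the traces of `(ad T) ^ 2` on
the components of the grading. -/
lemma sum_sq_rootClass_zero :
    (f4Roots.map fun a => if rootClass a = 0 then a 3 ^ 2 else 0).sum = 48 := by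
  decide +kernel

lemma sum_sq_rootClass :
    ∀ i ≠ 0, (f4Roots.map fun a => if rootClass a = i then a 3 ^ 2 else 0).sum = 8 := by
  decide +kernel

lemma rootClass_add (a b : Fin 4 → ℤ) : rootClass (a + b) = rootClass a ^^^ rootClass b := by
  simp only [rootClass, Pi.add_apply, Int.even_add]
  by_cases h1 : Even (a 3) <;> by_cases h2 : Even (a 2) <;> by_cases h3 : Even (b 3) <;>
    by_cases h4 : Even (b 2) <;> simp [h1, h2, h3, h4]

lemma sum_pos_of_mem_d4SimpleRoots : ∀ b ∈ d4SimpleRoots, 0 < ∑ i, b i := by decide +kernel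

lemma sum_le_of_mem_f4Roots : ∀ a ∈ f4Roots, ∑ i, a i ≤ 11 := by decide +kernel

lemma rootClass_neg (a : Fin 4 → ℤ) : rootClass (-a) = rootClass a := by simp [rootClass]

lemma rootClass_zero : rootClass 0 = 0 := by simp [rootClass]

/-- The roots are obtained from the simple roots by simple reflections and negation. -/
lemma f4Roots_induction {p : (Fin 4 → ℤ) → Prop} (h1 : ∀ j, p (Pi.single j 1))
    (h2 : ∀ a, p a → ∀ j, p (f4Reflect j a)) (h3 : ∀ a, p a → p (-a)) :
    ∀ a ∈ f4Roots, p a := by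
  have hinv : ∀ j a, f4Reflect j (f4Reflect j a) = a := by
    intro j a
    have h4 : ∑ i, f4Reflect j a i * CartanMatrix.F₄ i j = -∑ i, a i * CartanMatrix.F₄ i j := by
      simp only [f4Reflect, Pi.sub_apply, sub_mul, Finset.sum_sub_distrib]
      have : ∑ i, ((∑ k, a k * CartanMatrix.F₄ k j) • (Pi.single j 1 : Fin 4 → ℤ)) i *
          CartanMatrix.F₄ i j = (∑ k, a k * CartanMatrix.F₄ k j) * 2 := by
        rw [Finset.sum_eq_single j]
        · simp
        · intro i _ hi; simp [Pi.single_eq_of_ne hi]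
        · simp
      rw [this]; ring
    conv_lhs => rw [f4Reflect, h4]
    simp [f4Reflect]
  have hpos : ∀ N : ℕ, ∀ a ∈ f4PositiveRoots, (∑ i, a i).toNat = N → p a := by
    intro N
    induction N using Nat.strong_induction_on with
    | _ N ih =>
      intro a ha hN
      rcases exists_f4Reflect_lt a ha with ⟨j, rfl⟩ | ⟨j, hj, hlt⟩
      · exact h1 j
      · rw [← hinv j a]
        have hp : ∀ a ∈ f4PositiveRoots, 0 < ∑ i, a i := by decide +kernel
        refine h2 _ (ih _ ?_ _ hj rfl) j
        have := hp _ hj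
        omega
  intro a ha
  rcases List.mem_append.1 ha with h | h
  · exact hpos _ a h rfl
  · obtain ⟨b, hb, rfl⟩ := List.mem_map.1 h
    exact h3 _ (hpos _ b hb rfl)

end RootsOfF4
end EinsteinF4

/-! ### The root space decomposition in coordinates -/

namespace EinsteinF4
namespace FundamentalSystemF4
open LieAlgebra LieAlgebra.IsKilling LieModule Module

variable {𝔤 : Type*} [LieRing 𝔤] [LieAlgebra ℝ 𝔤] [Module.Finite ℝ 𝔤] [LieAlgebra.IsKilling ℝ 𝔤]
  (S : FundamentalSystemF4 𝔤)

/-- The integral combination of the simple roots with coordinates `a`. -/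
noncomputable def rootVec (a : Fin 4 → ℤ) : Dual ℂ (complexify S.t) :=
  ∑ j, a j • (rootSystem (complexify S.t)).root (S.idx j)

lemma rootVec_add (a b : Fin 4 → ℤ) : S.rootVec (a + b) = S.rootVec a + S.rootVec b := by
  simp [rootVec, add_smul, Finset.sum_add_distrib]

lemma rootVec_neg (a : Fin 4 → ℤ) : S.rootVec (-a) = -S.rootVec a := by
  simp [rootVec]

lemma rootVec_zero : S.rootVec 0 = 0 := by simp [rootVec]

lemma rootVec_smul (k : ℤ) (a : Fin 4 → ℤ) : S.rootVec (k • a) = k • S.rootVec a := by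
  simp [rootVec, Finset.smul_sum, mul_smul]

lemma rootVec_single (j : Fin 4) :
    S.rootVec (Pi.single j 1) = (rootSystem (complexify S.t)).root (S.idx j) := by
  rw [rootVec, Finset.sum_eq_single j]
  · simp
  · intro i _ hi; simp [Pi.single_eq_of_ne hi]
  · simp

lemma linearIndependent_root :
    LinearIndependent ℂ fun j => (rootSystem (complexify S.t)).root (S.idx j) :=
  (S.base.linearIndepOn_root.linearIndependent).comp _ S.idx.injective

lemma rootVec_injective : Function.Injective S.rootVec := by
  intro a b h
  have h1 := Fintype.linearIndependent_iff.1 S.linearIndependent_root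
    (fun j => ((a j - b j : ℤ) : ℂ)) (by
      rw [← sub_eq_zero, rootVec, rootVec, ← Finset.sum_sub_distrib] at h
      rw [← h]
      refine Finset.sum_congr rfl fun j _ => ?_
      rw [Int.cast_smul_eq_zsmul, sub_smul])
  funext j
  have := h1 j
  rw [Int.cast_eq_zero] at this
  omega

lemma pairing_eq (i j : Fin 4) :
    (rootSystem (complexify S.t)).pairing (S.idx i) (S.idx j) = (CartanMatrix.F₄ i j : ℂ) := by
  rw [← S.cartanMatrix_eq, ← S.base.algebraMap_cartanMatrixIn_apply ℤ]
  simp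

lemma reflection_rootVec (j : Fin 4) (a : Fin 4 → ℤ) :
    (rootSystem (complexify S.t)).reflection (S.idx j) (S.rootVec a) =
      S.rootVec (f4Reflect j a) := by
  rw [f4Reflect, sub_eq_add_neg, ← neg_smul, rootVec_add, rootVec_smul, rootVec_single, rootVec,
    map_sum, neg_smul, ← sub_eq_add_neg, Finset.sum_smul, ← Finset.sum_sub_distrib]
  refine Finset.sum_congr rfl fun i _ => ?_
  rw [map_zsmul, RootPairing.reflection_apply_root, pairing_eq, smul_sub, mul_smul,
    Int.cast_smul_eq_zsmul]

lemma exists_root_eq : ∀ a ∈ f4Roots, ∃ i, (rootSystem (complexify S.t)).root i = S.rootVec a := by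
  apply f4Roots_induction
  · exact fun j => ⟨S.idx j, (S.rootVec_single j).symm⟩
  · rintro a ⟨i, hi⟩ j
    exact ⟨(rootSystem (complexify S.t)).reflectionPerm (S.idx j) i, by
      rw [RootPairing.root_reflectionPerm, hi, reflection_rootVec]⟩
  · rintro a ⟨i, hi⟩
    exact ⟨(rootSystem (complexify S.t)).reflectionPerm i i, by
      rw [RootPairing.root_reflectionPerm, RootPairing.reflection_apply_self, hi, rootVec_neg]⟩

lemma exists_coords (i : (complexify S.t).root) :
    ∃ a ∈ f4Roots, (rootSystem (complexify S.t)).root i = S.rootVec a := by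
  refine S.base.induction_reflect i
    (p := fun i => ∃ a ∈ f4Roots, (rootSystem (complexify S.t)).root i = S.rootVec a) ?_ ?_ ?_
  · rintro i ⟨a, ha, hi⟩
    exact ⟨-a, neg_mem_f4Roots a ha, by
      rw [RootPairing.root_reflectionPerm, RootPairing.reflection_apply_self, hi, rootVec_neg]⟩
  · intro i hi
    obtain ⟨j, hj⟩ := S.idx.surjective ⟨i, hi⟩
    exact ⟨Pi.single j 1, single_mem_f4Roots j, by rw [rootVec_single, hj]⟩
  · rintro i k ⟨a, ha, hi⟩ hk
    obtain ⟨j, hj⟩ := S.idx.surjective ⟨k, hk⟩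
    obtain rfl : (S.idx j : (complexify S.t).root) = k := by rw [hj]
    exact ⟨f4Reflect j a, f4Reflect_mem_f4Roots a ha j, by
      rw [RootPairing.root_reflectionPerm, hi, reflection_rootVec]⟩

/-- The weight space of `ℂ ⊗ 𝔤` for the integral combination of the simple roots with
coordinates `a`. -/
noncomputable abbrev space (a : Fin 4 → ℤ) : LieSubmodule ℂ (complexify S.t) (ℂ ⊗[ℝ] 𝔤) :=
  rootSpace (complexify S.t) (S.rootVec a)

lemma space_zero : S.space 0 = (complexify S.t).toLieSubmodule := by
  rw [space, rootVec_zero]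
  exact rootSpace_zero_eq ℂ _ (complexify S.t)

lemma mem_space_zero {x : ℂ ⊗[ℝ] 𝔤} : x ∈ S.space 0 ↔ x ∈ complexify S.t := by
  rw [space_zero]; rfl

lemma lie_of_mem_space {a : Fin 4 → ℤ} {x : ℂ ⊗[ℝ] 𝔤} (hx : x ∈ S.space a) (h : complexify S.t) :
    ⁅(h : ℂ ⊗[ℝ] 𝔤), x⁆ = S.rootVec a h • x :=
  lie_eq_smul_of_mem_rootSpace hx h

lemma mem_space_iff {a : Fin 4 → ℤ} {x : ℂ ⊗[ℝ] 𝔤} :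
    x ∈ S.space a ↔ ∀ h : complexify S.t, ⁅(h : ℂ ⊗[ℝ] 𝔤), x⁆ = S.rootVec a h • x := by
  refine ⟨fun hx h => S.lie_of_mem_space hx h, fun hx => ?_⟩
  exact weightSpace_le_genWeightSpace _ _ ((mem_weightSpace _ x).2 hx)

lemma lie_mem_space {a b : Fin 4 → ℤ} {x y : ℂ ⊗[ℝ] 𝔤} (hx : x ∈ S.space a) (hy : y ∈ S.space b) :
    ⁅x, y⁆ ∈ S.space (a + b) := by
  rw [space, rootVec_add]
  exact lie_mem_genWeightSpace_of_mem_genWeightSpace hx hy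

lemma weight_cases (w : Weight ℂ (complexify S.t) (ℂ ⊗[ℝ] 𝔤)) :
    ∃ a, (a = 0 ∨ a ∈ f4Roots) ∧ (w : complexify S.t → ℂ) = S.rootVec a := by
  by_cases hw : w.IsZero
  · exact ⟨0, Or.inl rfl, by rw [rootVec_zero, hw.eq]; rfl⟩
  · obtain ⟨a, ha, h⟩ := S.exists_coords ⟨w, by simpa using hw⟩
    exact ⟨a, Or.inr ha, by rw [← h]; rfl⟩

lemma space_eq_bot {a : Fin 4 → ℤ} (h0 : a ≠ 0) (ha : a ∉ f4Roots) : S.space a = ⊥ := by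
  by_contra h
  obtain ⟨b, hb, hab⟩ := S.weight_cases ⟨S.rootVec a, h⟩
  have : a = b := S.rootVec_injective (DFunLike.coe_injective hab)
  subst this
  rcases hb with hb | hb
  exacts [h0 hb, ha hb]

lemma eq_top_of_space_le {N : Submodule ℂ (ℂ ⊗[ℝ] 𝔤)}
    (h : ∀ a, a = 0 ∨ a ∈ f4Roots → (S.space a).toSubmodule ≤ N) : N = ⊤ := by
  have h1 := iSup_genWeightSpace_eq_top' ℂ (complexify S.t) (ℂ ⊗[ℝ] 𝔤)
  rw [← LieSubmodule.toSubmodule_inj, LieSubmodule.iSup_toSubmodule,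
    LieSubmodule.top_toSubmodule] at h1
  rw [eq_top_iff, ← h1, iSup_le_iff]
  intro w
  obtain ⟨a, ha, hw⟩ := S.weight_cases w
  rw [hw]
  exact h a ha

lemma hom_ext {M : Type*} [AddCommGroup M] [Module ℂ M] {f g : (ℂ ⊗[ℝ] 𝔤) →ₗ[ℂ] M}
    (h : ∀ a, ∀ x ∈ S.space a, f x = g x) : f = g := by
  have := S.eq_top_of_space_le (N := LinearMap.eqLocus f g) fun a _ x hx => h a x hx
  exact LinearMap.eqLocus_eq_top.1 this

lemma isNonZero_and_eq {a : Fin 4 → ℤ} (ha : a ∈ f4Roots) :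
    ∃ w : Weight ℂ (complexify S.t) (ℂ ⊗[ℝ] 𝔤), w.IsNonZero ∧
      (w : complexify S.t → ℂ) = S.rootVec a := by
  obtain ⟨i, hi⟩ := S.exists_root_eq a ha
  exact ⟨i.1, (complexify S.t).isNonZero_coe_root i, by rw [← hi]; rfl⟩

lemma finrank_space {a : Fin 4 → ℤ} (ha : a ∈ f4Roots) : finrank ℂ (S.space a) = 1 := by
  obtain ⟨w, hw, hwa⟩ := S.isNonZero_and_eq ha
  rw [space, ← hwa]
  exact finrank_rootSpace_eq_one w hw

lemma finrank_cartan : finrank ℂ (complexify S.t) = 4 := by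
  rw [← Subspace.dual_finrank_eq,
    finrank_eq_card_basis (S.base.toWeightBasis.reindex S.idx.symm), Fintype.card_fin]

end FundamentalSystemF4
end EinsteinF4

/-! ### Eigenvectors of `e^{ad T}` -/

namespace EinsteinF4
section ExpAd

lemma _root_.Matrix.hasSum_exp {m : Type*} [Fintype m] [DecidableEq m] (M : Matrix m m ℝ) :
    HasSum (fun k : ℕ => (k.factorial : ℝ)⁻¹ • M ^ k) (NormedSpace.exp M) := by
  -- any normed algebra structure with the given topology will do
  let _ := Matrix.linftyOpNormedRing (n := m) (α := ℝ)
  let _ := Matrix.linftyOpNormedAlgebra (n := m) (R := ℝ) (α := ℝ)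
  exact NormedSpace.exp_series_hasSum_exp' (𝕂 := ℝ) M

variable {𝔤 : Type*} [LieRing 𝔤] [LieAlgebra ℝ 𝔤]

lemma ad_baseChange_apply (T : 𝔤) (x : ℂ ⊗[ℝ] 𝔤) :
    (LieAlgebra.ad ℝ 𝔤 T).baseChange ℂ x = ⁅(1 : ℂ) ⊗ₜ[ℝ] T, x⁆ := by
  induction x using TensorProduct.induction_on with
  | zero => exact (map_zero _).trans (LieAlgebra.ad ℂ (ℂ ⊗[ℝ] 𝔤) _).map_zero.symm
  | tmul z y => simp
  | add x y hx hy => rw [map_add, hx, hy, LieRing.lie_add]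

lemma expAd_baseChange_apply [Module.Finite ℝ 𝔤] (T : 𝔤) {x : ℂ ⊗[ℝ] 𝔤} {μ : ℂ}
    (h : ⁅(1 : ℂ) ⊗ₜ[ℝ] T, x⁆ = μ • x) :
    (expAd T).baseChange ℂ x = Complex.exp μ • x := by
  classical
  set b := Module.finBasis ℝ 𝔤 with hb
  set M := LinearMap.toMatrix b b (LieAlgebra.ad ℝ 𝔤 T) with hM
  set bC := Algebra.TensorProduct.basis ℂ b with hbC
  set c := bC.repr x with hc
  have hrepr : ∀ (f : Module.End ℝ 𝔤) (y : ℂ ⊗[ℝ] 𝔤), ⇑(bC.repr (f.baseChange ℂ y)) =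
      ((LinearMap.toMatrix b b f).map (algebraMap ℝ ℂ)).mulVec (bC.repr y) := by
    intro f y
    rw [← LinearMap.toMatrix_baseChange]
    exact (LinearMap.toMatrix_mulVec_repr bC bC (f.baseChange ℂ) y).symm
  have had : (LieAlgebra.ad ℝ 𝔤 T).baseChange ℂ x = μ • x := by
    rw [ad_baseChange_apply, h]
  have hpow : ∀ k : ℕ, ((M ^ k).map (algebraMap ℝ ℂ)).mulVec c = μ ^ k • ⇑c := by
    intro k
    induction k with
    | zero => simp [Matrix.map_one]
    | succ k ih =>
      rw [pow_succ', Matrix.map_mul, ← Matrix.mulVec_mulVec, ih, Matrix.mulVec_smul, hM, hc,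
        ← hrepr, had, map_smul, pow_succ]
      simp [mul_smul]
  have hcont : Continuous fun A : Matrix (Fin (Module.finrank ℝ 𝔤)) (Fin (Module.finrank ℝ 𝔤)) ℝ =>
      (A.map (algebraMap ℝ ℂ)).mulVec ⇑c := by
    refine Continuous.matrix_mulVec ?_ continuous_const
    exact Continuous.matrix_map continuous_id (by simpa using Complex.continuous_ofReal)
  have hsum := (Matrix.hasSum_exp M).map
    (AddMonoidHom.mk' (fun A : Matrix (Fin (Module.finrank ℝ 𝔤)) (Fin (Module.finrank ℝ 𝔤)) ℝ =>
        (A.map (algebraMap ℝ ℂ)).mulVec ⇑c) (by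
      intro A B
      rw [Matrix.map_add _ (map_add _), Matrix.add_mulVec])) hcont
  have hsum2 : HasSum (fun k : ℕ => ((k.factorial : ℂ)⁻¹ * μ ^ k) • ⇑c) (Complex.exp μ • ⇑c) := by
    have h1 := NormedSpace.exp_series_hasSum_exp' (𝕂 := ℂ) μ
    rw [← Complex.exp_eq_exp_ℂ] at h1
    simpa using h1.smul_const ⇑c
  have heq : ((NormedSpace.exp M).map (algebraMap ℝ ℂ)).mulVec ⇑c = Complex.exp μ • ⇑c := by
    refine hsum.unique (hsum2.congr_fun ?_)
    intro k
    simp only [Function.comp_apply, AddMonoidHom.mk'_apply]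
    rw [mul_smul, ← hpow]
    ext i
    simp [Matrix.mulVec, dotProduct, Finset.mul_sum, mul_assoc]
  apply bC.repr.injective
  ext i
  rw [hrepr, expAd, LinearMap.toMatrix_toLin, ← hc, heq, map_smul]
  simp [hc]

end ExpAd
end EinsteinF4

/-! ### Schur's lemma for the subsystem `D₄` -/

namespace EinsteinF4

section BaseChangeLie

variable {L : Type*} [LieRing L] [LieAlgebra ℝ L]

/-! The bracket that is found for `ℂ ⊗ L` is that of the base change; it does not unfold reducibly to
the one in the general lemmas on Lie rings, which are restated for this reason. -/

lemma baseChange_lie_smul (c : ℂ) (x y : ℂ ⊗[ℝ] L) : ⁅x, c • y⁆ = c • ⁅x, y⁆ :=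
  LieAlgebra.lie_smul c x y

lemma baseChange_lie_skew (x y : ℂ ⊗[ℝ] L) : -⁅y, x⁆ = ⁅x, y⁆ :=
  lie_skew x y

lemma baseChange_lie_zero (x : ℂ ⊗[ℝ] L) : ⁅x, (0 : ℂ ⊗[ℝ] L)⁆ = 0 :=
  (LieAlgebra.ad ℂ (ℂ ⊗[ℝ] L) x).map_zero

lemma baseChange_lie_add (x y z : ℂ ⊗[ℝ] L) : ⁅x, y + z⁆ = ⁅x, y⁆ + ⁅x, z⁆ :=
  LieRing.lie_add x y z

end BaseChangeLie

namespace FundamentalSystemF4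
open LieAlgebra LieAlgebra.IsKilling LieModule Module

variable {𝔤 : Type*} [LieRing 𝔤] [LieAlgebra ℝ 𝔤] [Module.Finite ℝ 𝔤] [LieAlgebra.IsKilling ℝ 𝔤]
  (S : FundamentalSystemF4 𝔤)

lemma space_neg_eq (b : Fin 4 → ℤ) :
    S.space (-b) = rootSpace (complexify S.t) (-⇑(S.rootVec b)) := by
  rw [space, rootVec_neg]
  rfl

/-- Root vectors `e`, `f` for opposite roots `±b`, with `[e, f]` the coroot of `b`. The last clause
is the representation theory of `𝔰𝔩₂` in the one form that is needed: if the `b`-string through `a`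
ends at `a + b`, then the reflection in `b` shows that `a + b` does not vanish on the coroot. -/
lemma exists_sl2_triple {b : Fin 4 → ℤ} (hb : b ∈ f4Roots) :
    ∃ (h : complexify S.t) (e f : ℂ ⊗[ℝ] 𝔤), e ∈ S.space b ∧ f ∈ S.space (-b) ∧ e ≠ 0 ∧
      ⁅e, f⁆ = h ∧ h ≠ 0 ∧ ∀ a ∈ f4Roots, a + b + b ∉ f4Roots → S.rootVec (a + b) h ≠ 0 := by
  obtain ⟨j, hj⟩ := S.exists_root_eq b hb
  have hj0 : j.1.IsNonZero := (complexify S.t).isNonZero_coe_root j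
  have hjb : (j.1 : complexify S.t → ℂ) = S.rootVec b := by rw [← hj]; rfl
  obtain ⟨h, e, f, ht, he, hf⟩ := exists_isSl2Triple_of_weight_isNonZero hj0
  have hh := ht.h_eq_coroot hj0 he hf
  refine ⟨coroot j.1, e, f, by rw [space, ← hjb]; exact he,
    by rw [space_neg_eq, ← hjb]; exact hf, ht.e_ne_zero, by rw [ht.lie_e_f, hh], ?_, ?_⟩
  · rw [ne_eq, coroot_eq_zero_iff]
    exact hj0
  · intro a ha hab h0
    obtain ⟨i, hi⟩ := S.exists_root_eq a ha
    obtain ⟨c, hc, hic⟩ := S.exists_coords ((rootSystem (complexify S.t)).reflectionPerm j i)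
    have h2 : S.rootVec b (coroot j.1) = 2 := by
      rw [← hjb]; exact root_apply_coroot hj0
    have h3 : (rootSystem (complexify S.t)).pairing i j = -2 := by
      have : (rootSystem (complexify S.t)).pairing i j = S.rootVec a (coroot j.1) := by
        rw [← hi]; rfl
      rw [rootVec_add, LinearMap.add_apply, h2] at h0
      rw [this]
      linear_combination h0
    rw [RootPairing.root_reflectionPerm, RootPairing.reflection_apply_root, h3, hi, hj, neg_smul,
      sub_neg_eq_add, two_smul, ← rootVec_add, ← rootVec_add, ← add_assoc] at hic
    exact hab (S.rootVec_injective hic ▸ hc)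

/-- The simple roots of `D₄` span the dual of the Cartan subalgebra. -/
lemma eq_zero_of_rootVec_eq_zero {h : complexify S.t}
    (hh : ∀ b ∈ d4SimpleRoots, S.rootVec b h = 0) : h = 0 := by
  have h1 : S.rootVec ![1, 0, 0, 0] h = 0 := hh _ (by simp [d4SimpleRoots])
  have h2 : S.rootVec ![0, 1, 0, 0] h = 0 := hh _ (by simp [d4SimpleRoots])
  have h3 : S.rootVec ![0, 1, 2, 0] h = 0 := hh _ (by simp [d4SimpleRoots])
  have h4 : S.rootVec ![0, 1, 2, 2] h = 0 := hh _ (by simp [d4SimpleRoots])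
  simp only [rootVec, Fin.sum_univ_four, LinearMap.add_apply, LinearMap.smul_apply,
    Matrix.cons_val, one_smul, zero_smul, zero_add, add_zero] at h1 h2 h3 h4
  rw [h2, zero_add] at h3 h4
  rw [h3, zero_add] at h4
  have hall : ∀ j, (rootSystem (complexify S.t)).root (S.idx j) h = 0 := by
    intro j
    fin_cases j
    exacts [h1, h2, (smul_eq_zero.1 h3).resolve_left two_ne_zero,
      (smul_eq_zero.1 h4).resolve_left two_ne_zero]
  have h5 : Dual.eval ℂ (complexify S.t) h = 0 := by
    refine (S.base.toWeightBasis.reindex S.idx.symm).ext fun j => ?_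
    simpa using hall j
  exact (Module.forall_dual_apply_eq_zero_iff ℂ h).1 fun g => DFunLike.congr_fun h5 g

variable {S} {A : Module.End ℂ (ℂ ⊗[ℝ] 𝔤)}

/-- Schur's lemma for the subalgebra of type `D₄`: an endomorphism that commutes with it is a scalar
on the sum of the weight spaces of each component of the Klein grading. -/
lemma exists_eq_smul_of_commute
    (hA : ∀ b, rootClass b = 0 → ∀ x ∈ S.space b, ∀ y, A ⁅x, y⁆ = ⁅x, A y⁆) :
    ∃ c : Fin 4 → ℂ, ∀ a, ∀ x ∈ S.space a, A x = c (rootClass a) • x := by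
  have hpres : ∀ a, ∀ x ∈ S.space a, A x ∈ S.space a := by
    intro a x hx
    rw [mem_space_iff] at hx ⊢
    intro h
    rw [← hA 0 rootClass_zero _ (S.mem_space_zero.2 h.2), hx, map_smul]
  have hl : ∀ a, ∃ l : ℂ, a ∈ f4Roots → ∀ x ∈ S.space a, A x = l • x := by
    intro a
    by_cases ha : a ∈ f4Roots
    · obtain ⟨v, hv0, hv⟩ := finrank_eq_one_iff'.1 (S.finrank_space ha)
      obtain ⟨l, hl⟩ := hv ⟨A v, hpres a v v.2⟩
      refine ⟨l, fun _ x hx => ?_⟩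
      obtain ⟨d, hd⟩ := hv ⟨x, hx⟩
      have hd' : x = d • (v : ℂ ⊗[ℝ] 𝔤) := (congrArg Subtype.val hd).symm
      have hl' : A v = l • (v : ℂ ⊗[ℝ] 𝔤) := (congrArg Subtype.val hl).symm
      rw [hd', map_smul, hl', smul_comm]
    · exact ⟨0, fun h => absurd h ha⟩
  choose l hl using hl
  have hne : ∀ a ∈ f4Roots, ∃ x ∈ S.space a, x ≠ 0 := by
    intro a ha
    obtain ⟨h, e, f, he, -, h0, -⟩ := S.exists_sl2_triple ha
    exact ⟨e, he, h0⟩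
  -- apply `A` to `⁅e, ⁅f, x⁆⁆`, a nonzero multiple of `x`
  have hstep : ∀ a ∈ f4Roots, ∀ b ∈ f4Roots, rootClass b = 0 → a + b ∈ f4Roots →
      a + b + b ∉ f4Roots → a + b + b ≠ 0 → l a = l (a + b) := by
    intro a ha b hb hbc hab habb h0
    obtain ⟨h, e, f, he, hf, -, hef, -, hh⟩ := S.exists_sl2_triple hb
    obtain ⟨x, hx, hx0⟩ := hne _ hab
    have hfx : ⁅f, x⁆ ∈ S.space a := by
      have := S.lie_mem_space hf hx
      rwa [neg_add_eq_sub, add_sub_cancel_right] at this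
    have hex : ⁅e, x⁆ = 0 := by
      have := S.lie_mem_space he hx
      rw [add_comm b, S.space_eq_bot h0 habb] at this
      exact (LieSubmodule.mem_bot _).1 this
    have hefx : ⁅e, ⁅f, x⁆⁆ = S.rootVec (a + b) h • x := by
      rw [leibniz_lie, hex, hef, S.lie_of_mem_space hx,
        baseChange_lie_zero, add_zero]
    have h1 := hA b hbc e he ⁅f, x⁆
    rw [hl a ha _ hfx, baseChange_lie_smul, hefx, map_smul, hl _ hab x hx, smul_smul, smul_smul,
      ← sub_eq_zero, ← sub_smul, smul_eq_zero] at h1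
    have h2 := h1.resolve_right hx0
    rw [mul_comm (l a), ← mul_sub, mul_eq_zero, sub_eq_zero] at h2
    exact (h2.resolve_left (hh a ha habb)).symm
  -- apply `A` to `⁅e, f⁆`
  have hlneg : ∀ b ∈ f4Roots, rootClass b = 0 → l (-b) = l b := by
    intro b hb hbc
    obtain ⟨h, e, f, he, hf, -, hef, h0, -⟩ := S.exists_sl2_triple hb
    have h1 := hA b hbc e he f
    have h2 := hA (-b) (by rw [rootClass_neg, hbc]) f hf e
    rw [hl _ (neg_mem_f4Roots b hb) f hf, baseChange_lie_smul, hef] at h1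
    rw [hl b hb e he, baseChange_lie_smul, ← baseChange_lie_skew, hef, map_neg, h1, smul_neg, neg_inj,
      ← sub_eq_zero, ← sub_smul, smul_eq_zero] at h2
    exact sub_eq_zero.1 (h2.resolve_right (by simpa using h0))
  -- induction on the distance to 11, the height of the highest root
  have htop : ∀ N : ℕ, ∀ a ∈ f4Roots, (11 - ∑ i, a i).toNat = N →
      l a = l (topRoot (rootClass a)) := by
    intro N
    induction N using Nat.strong_induction_on with
    | _ N ih =>
      intro a ha hN
      rcases exists_add_mem_f4Roots a ha with h | ⟨b, hb, h⟩
      · rw [← h]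
      · obtain ⟨hbm, hbc⟩ := d4SimpleRoots_mem b hb
        have hpos := sum_pos_of_mem_d4SimpleRoots b hb
        rcases h with rfl | ⟨hab, habb, h0⟩
        · have hle := sum_le_of_mem_f4Roots b hbm
          rw [rootClass_neg, hlneg b hbm hbc]
          simp only [Pi.neg_apply, Finset.sum_neg_distrib] at hN
          exact ih _ (by omega) b hbm rfl
        · have hle := sum_le_of_mem_f4Roots _ hab
          have hc : rootClass (a + b) = rootClass a := by
            rw [rootClass_add, hbc]
            generalize rootClass a = k
            revert k; decide
          rw [hstep a ha b hbm hbc hab habb h0, ← hc]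
          refine ih _ ?_ _ hab rfl
          simp only [Pi.add_apply, Finset.sum_add_distrib] at hle ⊢
          omega
  refine ⟨fun i => l (topRoot i), fun a x hx => ?_⟩
  by_cases ha : a ∈ f4Roots
  · rw [hl a ha x hx, htop _ a ha rfl]
  by_cases ha0 : a = 0
  · subst ha0
    rw [rootClass_zero]
    have hAx := hpres 0 x hx
    rw [mem_space_zero] at hx hAx
    -- the simple roots of `D₄` take the same values on `A x` as on the multiple of `x`
    have key : (⟨A x, hAx⟩ - l (topRoot 0) • ⟨x, hx⟩ : complexify S.t) = 0 := by
      refine S.eq_zero_of_rootVec_eq_zero fun b hb => ?_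
      obtain ⟨hbm, hbc⟩ := d4SimpleRoots_mem b hb
      obtain ⟨e, he, he0⟩ := hne b hbm
      have h1 := hA b hbc e he x
      rw [← baseChange_lie_skew e x, ← baseChange_lie_skew e (A x), S.lie_of_mem_space he ⟨x, hx⟩,
        S.lie_of_mem_space he ⟨A x, hAx⟩, map_neg, neg_inj, map_smul, hl b hbm e he, smul_smul,
        ← sub_eq_zero, ← sub_smul, smul_eq_zero] at h1
      rw [map_sub, map_smul, smul_eq_mul, ← neg_eq_zero, neg_sub, mul_comm,
        ← hbc, ← htop _ b hbm rfl]
      exact h1.resolve_right he0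
    exact sub_eq_zero.1 (congrArg Subtype.val key)
  · rw [S.space_eq_bot ha0 ha] at hx
    rw [(LieSubmodule.mem_bot _).1 hx, map_zero, smul_zero]

end FundamentalSystemF4
end EinsteinF4

/-! ### Traces and exponentials on the weight spaces -/

namespace EinsteinF4
namespace FundamentalSystemF4
open LieAlgebra LieAlgebra.IsKilling LieModule Module

variable {𝔤 : Type*} [LieRing 𝔤] [LieAlgebra ℝ 𝔤] [Module.Finite ℝ 𝔤] [LieAlgebra.IsKilling ℝ 𝔤]
  (S : FundamentalSystemF4 𝔤)

/-- The factor 4 is the dimension of the Cartan subalgebra; the root spaces are lines. -/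
lemma trace_eq_of_forall_space {D : Module.End ℂ (ℂ ⊗[ℝ] 𝔤)} {f : (Fin 4 → ℤ) → ℂ}
    (hD : ∀ a, ∀ x ∈ S.space a, D x = f a • x) :
    LinearMap.trace ℂ _ D = 4 * f 0 + (f4Roots.map f).sum := by
  classical
  let s : Finset (Fin 4 → ℤ) := insert 0 f4Roots.toFinset
  let N : s → Submodule ℂ (ℂ ⊗[ℝ] 𝔤) := fun a => (S.space a).toSubmodule
  have hind : iSupIndep N := by
    rw [LieSubmodule.iSupIndep_toSubmodule]
    exact (iSupIndep_genWeightSpace ℂ (complexify S.t) (ℂ ⊗[ℝ] 𝔤)).comp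
      (f := fun a : s => ⇑(S.rootVec a))
      (DFunLike.coe_injective.comp (S.rootVec_injective.comp Subtype.val_injective))
  have htop : iSup N = ⊤ := S.eq_top_of_space_le fun a ha =>
    le_iSup N ⟨a, by simpa [s] using ha⟩
  have hint := DirectSum.isInternal_submodule_of_iSupIndep_of_iSup_eq_top hind htop
  have hmaps : ∀ a : s, Set.MapsTo D (N a) (N a) := fun a x hx => by
    rw [hD a x hx]; exact (N a).smul_mem _ hx
  have htr : ∀ a : s, LinearMap.trace ℂ (N a) (D.restrict (hmaps a)) =
      f a * (finrank ℂ (S.space a) : ℂ) := by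
    intro a
    have : D.restrict (hmaps a) = f a • LinearMap.id := by
      ext x
      exact hD a x x.2
    rw [this, map_smul, LinearMap.trace_id, smul_eq_mul]
    rfl
  have h0 : finrank ℂ (S.space 0) = 4 := by
    rw [space_zero]; exact S.finrank_cartan
  rw [LinearMap.trace_eq_sum_trace_restrict hint hmaps, Finset.sum_congr rfl fun a _ => htr a,
    Finset.sum_coe_sort s fun a => f a * (finrank ℂ (S.space a) : ℂ),
    Finset.sum_insert (by simpa using zero_notMem_f4Roots), h0,
    ← List.sum_toFinset f f4Roots_nodup]
  congr 1
  · push_cast; ring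
  · refine Finset.sum_congr rfl fun a ha => ?_
    rw [S.finrank_space (List.mem_toFinset.1 ha)]; simp

lemma rootVec_apply (a : Fin 4 → ℤ) (T : S.t) :
    S.rootVec a ⟨(1 : ℂ) ⊗ₜ[ℝ] (T : 𝔤), one_tmul_mem_complexify T.2⟩ =
      ∑ j, a j * S.simpleRoot j T := by
  simp [rootVec, simpleRoot, LinearMap.sum_apply]

lemma one_tmul_lie {a : Fin 4 → ℤ} {x : ℂ ⊗[ℝ] 𝔤} (hx : x ∈ S.space a) (T : S.t) :
    ⁅(1 : ℂ) ⊗ₜ[ℝ] (T : 𝔤), x⁆ = (∑ j, a j * S.simpleRoot j T) • x := by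
  rw [← rootVec_apply]
  exact S.lie_of_mem_space hx ⟨_, one_tmul_mem_complexify T.2⟩

lemma expAd_apply_of_mem_space {a : Fin 4 → ℤ} {x : ℂ ⊗[ℝ] 𝔤} (hx : x ∈ S.space a) {T : S.t}
    {m : ℤ} (h : ∑ j, a j * S.simpleRoot j T = m * (Real.pi * Complex.I)) :
    (expAd (T : 𝔤)).baseChange ℂ x = (if Even m then 1 else -1 : ℂ) • x := by
  rw [expAd_baseChange_apply _ (S.one_tmul_lie hx T), h, Complex.exp_int_mul, Complex.exp_pi_mul_I]
  split_ifs with hm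
  · rw [hm.neg_one_zpow]
  · rw [(Int.not_even_iff_odd.1 hm).neg_one_zpow]

end FundamentalSystemF4
end EinsteinF4

/-! ### The Klein grading of `F₄` -/

namespace EinsteinF4
section KleinProjections

variable {L : Type*} [LieRing L] [LieAlgebra ℝ L]

/-- The eigenvalue of `θ` on the `i`-th joint eigenspace. -/
noncomputable def thetaSign : Fin 4 → ℝ := ![1, 1, -1, -1]

/-- The eigenvalue of `τ` on the `i`-th joint eigenspace. -/
noncomputable def tauSign : Fin 4 → ℝ := ![1, -1, 1, -1]

/-- The projection to the `i`-th joint eigenspace of two commuting involutions `θ`, `τ`. -/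
noncomputable def kleinProj (θ τ : Module.End ℝ L) (i : Fin 4) : Module.End ℝ L :=
  (1 / 4 : ℝ) • ((1 + thetaSign i • θ) * (1 + tauSign i • τ))

lemma mem_jointEigenspace_iff {θ τ : Module.End ℝ L} {i : Fin 4} {x : L} :
    x ∈ jointEigenspace θ τ i ↔ θ x = thetaSign i • x ∧ τ x = tauSign i • x := by
  fin_cases i <;> simp [jointEigenspace, thetaSign, tauSign]

lemma kleinProj_apply_of_mem {θ τ : Module.End ℝ L} {i : Fin 4} {x : L}
    (hx : x ∈ jointEigenspace θ τ i) : kleinProj θ τ i x = x := by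
  obtain ⟨h1, h2⟩ := mem_jointEigenspace_iff.1 hx
  have h3 : thetaSign i * thetaSign i = 1 := by fin_cases i <;> norm_num [thetaSign]
  have h4 : tauSign i * tauSign i = 1 := by fin_cases i <;> norm_num [tauSign]
  simp only [kleinProj, LinearMap.smul_apply, Module.End.mul_apply, LinearMap.add_apply,
    Module.End.one_apply, h1, h2, map_add, map_smul, smul_add, smul_smul, h3, h4]
  module

lemma one_tmul_injective : Function.Injective fun x : L => (1 : ℂ) ⊗ₜ[ℝ] x :=
  Module.FaithfullyFlat.tensorProduct_mk_injective (A := ℝ) (B := ℂ) L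

lemma eq_of_baseChange_eq {f g : Module.End ℝ L}
    (h : f.baseChange ℂ = g.baseChange ℂ) : f = g := by
  ext x
  have := DFunLike.congr_fun h ((1 : ℂ) ⊗ₜ[ℝ] x)
  simp only [LinearMap.baseChange_tmul] at this
  exact one_tmul_injective this

/-- The real part `ℂ ⊗ L → L`. -/
noncomputable def baseChangeRe : ℂ ⊗[ℝ] L →ₗ[ℝ] L :=
  (TensorProduct.lid ℝ L).toLinearMap ∘ₗ Complex.reLm.rTensor L

@[simp] lemma baseChangeRe_tmul (c : ℂ) (x : L) : baseChangeRe (c ⊗ₜ[ℝ] x) = c.re • x := by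
  simp [baseChangeRe]

lemma IsKleinGrading.isInternal {P : Fin 4 → Module.End ℝ L} (hP : IsKleinGrading P)
    {h : Fin 4 → Submodule ℝ L} (hh : ∀ i x, x ∈ h i ↔ P i x = x) : DirectSum.IsInternal h := by
  apply DirectSum.isInternal_submodule_of_iSupIndep_of_iSup_eq_top
  · intro i
    rw [Submodule.disjoint_def]
    intro x hx hx'
    have hle : ⨆ j, ⨆ (_ : j ≠ i), h j ≤ LinearMap.ker (P i) := by
      refine iSup₂_le fun j hj y hy => ?_
      rw [LinearMap.mem_ker, ← (hh j y).1 hy]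
      exact hP.apply_of_ne hj.symm y
    rw [← (hh i x).1 hx]
    exact hle hx'
  · rw [eq_top_iff]
    intro x _
    rw [← hP.sum_apply x]
    exact Submodule.sum_mem _ fun i _ =>
      Submodule.mem_iSup_of_mem i ((hh i _).2 (hP.apply_self i x))

end KleinProjections

namespace FundamentalSystemF4
open LieAlgebra LieAlgebra.IsKilling LieModule Module

variable {𝔤 : Type*} [LieRing 𝔤] [LieAlgebra ℝ 𝔤] [Module.Finite ℝ 𝔤] [LieAlgebra.IsKilling ℝ 𝔤]
  (S : FundamentalSystemF4 𝔤)

@[elab_as_elim]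
lemma space_induction {p : ℂ ⊗[ℝ] 𝔤 → Prop} (mem : ∀ a, ∀ x ∈ S.space a, p x) (zero : p 0)
    (add : ∀ x y, p x → p y → p (x + y)) (x : ℂ ⊗[ℝ] 𝔤) : p x := by
  have h := S.eq_top_of_space_le fun a _ => le_iSup (fun a => (S.space a).toSubmodule) a
  exact Submodule.iSup_induction _ (motive := p)
    (h ▸ Submodule.mem_top : x ∈ ⨆ a, (S.space a).toSubmodule)
    mem zero add

/-- `θ` and `τ` act on the weight spaces by the signs of the parities of the last two
coordinates. -/
structure IsSignPair (θ τ : Module.End ℝ 𝔤) : Prop where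
  theta : ∀ a, ∀ x ∈ S.space a, θ.baseChange ℂ x = (if Even (a 3) then 1 else -1 : ℂ) • x
  tau : ∀ a, ∀ x ∈ S.space a, τ.baseChange ℂ x = (if Even (a 2) then 1 else -1 : ℂ) • x

lemma isSignPair_expAd {T T' : S.t}
    (hT₁ : S.simpleRoot 0 T = 0) (hT₂ : S.simpleRoot 1 T = 0) (hT₃ : S.simpleRoot 2 T = 0)
    (hT₄ : S.simpleRoot 3 T = Real.pi * Complex.I)
    (hT'₁ : S.simpleRoot 0 T' = 0) (hT'₂ : S.simpleRoot 1 T' = 0)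
    (hT'₃ : S.simpleRoot 2 T' = Real.pi * Complex.I)
    (hT'φ : 2 * S.simpleRoot 0 T' + 3 * S.simpleRoot 1 T' + 4 * S.simpleRoot 2 T'
      + 2 * S.simpleRoot 3 T' = 0) :
    S.IsSignPair (expAd (T : 𝔤)) (expAd (T' : 𝔤)) where
  theta a x hx := S.expAd_apply_of_mem_space hx (by
    simp [Fin.sum_univ_four, hT₁, hT₂, hT₃, hT₄])
  tau a x hx := by
    have h4 : S.simpleRoot 3 T' = -2 * (Real.pi * Complex.I) := by
      rw [hT'₁, hT'₂, hT'₃] at hT'φ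
      linear_combination hT'φ / 2
    rw [S.expAd_apply_of_mem_space hx (m := a 2 - 2 * a 3) (by
      rw [Fin.sum_univ_four, hT'₁, hT'₂, hT'₃, h4]; push_cast; ring)]
    simp [Int.even_sub]

namespace IsSignPair
variable {S} {θ τ : Module.End ℝ 𝔤} (h : S.IsSignPair θ τ)
include h

lemma kleinProj_apply {a : Fin 4 → ℤ} {x : ℂ ⊗[ℝ] 𝔤} (hx : x ∈ S.space a) (i : Fin 4) :
    (kleinProj θ τ i).baseChange ℂ x = (if rootClass a = i then 1 else 0 : ℂ) • x := by
  have h1 := h.theta a x hx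
  have h2 := h.tau a x hx
  simp only [kleinProj, LinearMap.baseChange_smul, LinearMap.baseChange_mul,
    LinearMap.baseChange_add, LinearMap.baseChange_one, LinearMap.smul_apply, Module.End.mul_apply,
    LinearMap.add_apply, Module.End.one_apply, h2, map_add, map_smul, LinearMap.map_smul_of_tower,
    h1, rootClass]
  by_cases h3 : Even (a 3) <;> by_cases h4 : Even (a 2) <;> fin_cases i <;>
    simp [thetaSign, tauSign, h3, h4] <;> module

lemma isKleinGrading : IsKleinGrading (kleinProj θ τ) where
  apply_apply i j x := by
    have : kleinProj θ τ i * kleinProj θ τ j = if i = j then kleinProj θ τ i else 0 := by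
      apply eq_of_baseChange_eq
      refine S.hom_ext fun a x hx => ?_
      rw [LinearMap.baseChange_mul, Module.End.mul_apply, h.kleinProj_apply hx, map_smul,
        h.kleinProj_apply hx]
      by_cases hij : i = j
      · subst hij
        rw [if_pos rfl, h.kleinProj_apply hx]
        split_ifs <;> simp
      · rw [if_neg hij]
        split_ifs with h1 h2 <;> simp_all
    rw [← Module.End.mul_apply, this]
    split_ifs <;> rfl
  sum_apply x := by
    have : ∑ i, kleinProj θ τ i = 1 := by
      apply eq_of_baseChange_eq
      refine S.hom_ext fun a x hx => ?_
      simp only [Fin.sum_univ_four, LinearMap.baseChange_add, LinearMap.add_apply,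
        h.kleinProj_apply hx, LinearMap.baseChange_one, Module.End.one_apply]
      generalize rootClass a = k
      fin_cases k <;> simp
    rw [← LinearMap.sum_apply, this, Module.End.one_apply]
  apply_lie i j x y := by
    have key : ∀ X Y : ℂ ⊗[ℝ] 𝔤, (kleinProj θ τ (i ^^^ j)).baseChange ℂ
        ⁅(kleinProj θ τ i).baseChange ℂ X, (kleinProj θ τ j).baseChange ℂ Y⁆ =
        ⁅(kleinProj θ τ i).baseChange ℂ X, (kleinProj θ τ j).baseChange ℂ Y⁆ := by
      intro X Y
      induction X using S.space_induction with
      | zero => rw [map_zero, zero_lie, map_zero]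
      | add X X' hX hX' => rw [map_add, add_lie, map_add, hX, hX']
      | mem a X hX =>
        induction Y using S.space_induction with
        | zero => rw [map_zero, baseChange_lie_zero, map_zero]
        | add Y Y' hY hY' => rw [map_add, baseChange_lie_add, map_add, hY, hY']
        | mem b Y hY =>
          rw [h.kleinProj_apply hX, h.kleinProj_apply hY, smul_lie, baseChange_lie_smul, map_smul,
            map_smul, h.kleinProj_apply (S.lie_mem_space hX hY), rootClass_add]
          split_ifs <;> simp_all
    have := key ((1 : ℂ) ⊗ₜ[ℝ] x) ((1 : ℂ) ⊗ₜ[ℝ] y)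
    simp only [LinearMap.baseChange_tmul, LieAlgebra.ExtendScalars.bracket_tmul, mul_one] at this
    exact one_tmul_injective this

lemma mem_jointEigenspace_iff (i : Fin 4) (x : 𝔤) :
    x ∈ jointEigenspace θ τ i ↔ kleinProj θ τ i x = x := by
  refine ⟨kleinProj_apply_of_mem, fun hx => ?_⟩
  have h1 : θ * kleinProj θ τ i = thetaSign i • kleinProj θ τ i := by
    apply eq_of_baseChange_eq
    refine S.hom_ext fun a x hx => ?_
    rw [LinearMap.baseChange_mul, LinearMap.baseChange_smul, Module.End.mul_apply,
      LinearMap.smul_apply, h.kleinProj_apply hx, map_smul, h.theta a x hx]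
    by_cases h3 : Even (a 3) <;> by_cases h4 : Even (a 2) <;> fin_cases i <;>
      simp [thetaSign, rootClass, h3, h4]
  have h2 : τ * kleinProj θ τ i = tauSign i • kleinProj θ τ i := by
    apply eq_of_baseChange_eq
    refine S.hom_ext fun a x hx => ?_
    rw [LinearMap.baseChange_mul, LinearMap.baseChange_smul, Module.End.mul_apply,
      LinearMap.smul_apply, h.kleinProj_apply hx, map_smul, h.tau a x hx]
    by_cases h3 : Even (a 3) <;> by_cases h4 : Even (a 2) <;> fin_cases i <;>
      simp [tauSign, rootClass, h3, h4]
  rw [EinsteinF4.mem_jointEigenspace_iff]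
  constructor
  · simpa [hx] using DFunLike.congr_fun h1 x
  · simpa [hx] using DFunLike.congr_fun h2 x

lemma exists_apply_kleinProj_eq_smul {A : Module.End ℝ 𝔤}
    (hA : ∀ x y, A ⁅kleinProj θ τ 0 x, y⁆ = ⁅kleinProj θ τ 0 x, A y⁆) (i : Fin 4) :
    ∃ c : ℝ, ∀ x, A (kleinProj θ τ i x) = c • kleinProj θ τ i x := by
  have hA' : ∀ X Y : ℂ ⊗[ℝ] 𝔤, A.baseChange ℂ ⁅(kleinProj θ τ 0).baseChange ℂ X, Y⁆ =
      ⁅(kleinProj θ τ 0).baseChange ℂ X, A.baseChange ℂ Y⁆ := by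
    intro X Y
    induction X using TensorProduct.induction_on with
    | zero => rw [map_zero, zero_lie, map_zero, zero_lie]
    | add X X' hX hX' => rw [map_add, add_lie, map_add, hX, hX', add_lie]
    | tmul c x =>
      induction Y using TensorProduct.induction_on with
      | zero => rw [map_zero, baseChange_lie_zero, map_zero]
      | add Y Y' hY hY' => rw [map_add, baseChange_lie_add, map_add, hY, hY', baseChange_lie_add]
      | tmul d y =>
        simp only [LinearMap.baseChange_tmul, LieAlgebra.ExtendScalars.bracket_tmul, hA]
  obtain ⟨c, hc⟩ := exists_eq_smul_of_commute (S := S) (A := A.baseChange ℂ) (by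
    intro b hb x hx y
    have := hA' x y
    rwa [h.kleinProj_apply hx, if_pos hb, one_smul] at this)
  -- `A` is real, so the real part of the complex scalar does as well
  refine ⟨(c i).re, fun x => ?_⟩
  have h1 : (A * kleinProj θ τ i).baseChange ℂ = c i • (kleinProj θ τ i).baseChange ℂ := by
    refine S.hom_ext fun a x hx => ?_
    rw [LinearMap.baseChange_mul, Module.End.mul_apply, LinearMap.smul_apply, h.kleinProj_apply hx]
    split_ifs with hi
    · rw [one_smul, hc a x hx, hi]
    · simp
  simpa [TensorProduct.smul_tmul'] using congrArg baseChangeRe (DFunLike.congr_fun h1 (1 ⊗ₜ[ℝ] x))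

/-- The coordinate `0` stands for the Cartan subalgebra, which has dimension 4. -/
lemma trace_kleinProj_mul {D : Module.End ℝ 𝔤} {r : ℝ} {g : (Fin 4 → ℤ) → ℤ}
    (hD : ∀ a, ∀ x ∈ S.space a, D.baseChange ℂ x = ((r * g a : ℝ) : ℂ) • x) (i : Fin 4) :
    LinearMap.trace ℝ 𝔤 (D * kleinProj θ τ i) = r * ((4 * if rootClass 0 = i then g 0 else 0) +
      (f4Roots.map fun a => if rootClass a = i then g a else 0).sum : ℤ) := by
  have h1 := S.trace_eq_of_forall_space (D := (D * kleinProj θ τ i).baseChange ℂ)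
    (f := fun a => (r : ℂ) * ((if rootClass a = i then g a else 0 : ℤ) : ℂ)) (by
      intro a x hx
      rw [LinearMap.baseChange_mul, Module.End.mul_apply, h.kleinProj_apply hx, map_smul,
        hD a x hx]
      split_ifs <;> simp)
  rw [LinearMap.trace_baseChange, List.sum_map_mul_left] at h1
  have h2 : ((f4Roots.map fun a => ((if rootClass a = i then g a else 0 : ℤ) : ℂ)).sum) =
      (((f4Roots.map fun a => if rootClass a = i then g a else 0).sum : ℤ) : ℂ) := by
    rw [Int.cast_list_sum, List.map_map]
    rfl
  rw [h2] at h1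
  generalize (f4Roots.map fun a => if rootClass a = i then g a else 0).sum = s at h1 ⊢
  apply Complex.ofReal_injective
  refine (show ((LinearMap.trace ℝ 𝔤 (D * kleinProj θ τ i) : ℝ) : ℂ) = _ from h1).trans ?_
  push_cast
  split_ifs <;> push_cast <;> ring

lemma isSpinGrading {T : S.t}
    (hT₁ : S.simpleRoot 0 T = 0) (hT₂ : S.simpleRoot 1 T = 0) (hT₃ : S.simpleRoot 2 T = 0)
    (hT₄ : S.simpleRoot 3 T = Real.pi * Complex.I) : IsSpinGrading (kleinProj θ τ) where
  toIsKleinGrading := h.isKleinGrading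
  schur A hA i := h.exists_apply_kleinProj_eq_smul hA i
  trace_zero := by
    have := h.trace_kleinProj_mul (D := 1) (r := 1) (g := fun _ => 1) (by simp) 0
    rw [sum_rootClass_zero, one_mul] at this
    simpa [rootClass_zero] using this
  trace_ne_zero i hi := by
    have := h.trace_kleinProj_mul (D := 1) (r := 1) (g := fun _ => 1) (by simp) i
    rw [sum_rootClass i hi, one_mul] at this
    simpa [rootClass_zero, hi.symm] using this
  exists_neutral := by
    have hD : ∀ a, ∀ x ∈ S.space a, (ad ℝ 𝔤 (T : 𝔤) * ad ℝ 𝔤 (T : 𝔤)).baseChange ℂ x =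
        ((-(Real.pi ^ 2) * (a 3 ^ 2 : ℤ) : ℝ) : ℂ) • x := by
      intro a x hx
      rw [LinearMap.baseChange_mul, Module.End.mul_apply, ad_baseChange_apply (T : 𝔤) x,
        S.one_tmul_lie hx, map_smul, ad_baseChange_apply, S.one_tmul_lie hx, smul_smul,
        Fin.sum_univ_four, hT₁, hT₂, hT₃, hT₄]
      congr 1
      push_cast
      linear_combination (a 3 : ℂ) ^ 2 * (Real.pi : ℂ) ^ 2 * Complex.I_sq
    refine ⟨T, ?_, -(Real.pi ^ 2) * 8, by simp [Real.pi_ne_zero], ?_, fun i hi => ?_⟩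
    · have h1 := h.kleinProj_apply (S.mem_space_zero.2 (one_tmul_mem_complexify T.2)) 0
      rw [rootClass_zero, if_pos rfl, one_smul, LinearMap.baseChange_tmul] at h1
      exact one_tmul_injective h1
    · rw [h.trace_kleinProj_mul hD 0, sum_sq_rootClass_zero]
      simp
      ring
    · rw [h.trace_kleinProj_mul hD i, sum_sq_rootClass i hi]
      simp

end IsSignPair
end FundamentalSystemF4
end EinsteinF4

/-! ### Invariant metrics and Einstein metrics -/

namespace EinsteinF4
section InvariantMetrics

lemma IsSpinGrading.exists_isBlockSum {L : Type*} [LieRing L] [LieAlgebra ℝ L] [Module.Finite ℝ L]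
    {P : Fin 4 → Module.End ℝ L} (hP : IsSpinGrading P) {B : LinearMap.BilinForm ℝ L}
    (hB : IsAssociativeInnerProduct B) {h : Fin 4 → Submodule ℝ L}
    (hh : ∀ i x, x ∈ h i ↔ P i x = x) {q : LinearMap.BilinForm ℝ L} (hq : IsInnerProduct q)
    (hinv : ∀ x y z, q ⁅P 0 x, y⁆ z = -q y ⁅P 0 x, z⁆) :
    ∃ u : Fin 4 → ℝ, (∀ i, 0 < u i) ∧ IsBlockSum h B u q := by
  choose u hu using hP.exists_eq_smul_of_invariant hB q hinv
  refine ⟨u, fun i => ?_, fun i j x hx y hy => ?_⟩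
  · obtain ⟨x, hx⟩ := hP.exists_apply_ne_zero i
    have h1 := hq.pos _ hx
    rw [hu] at h1
    exact pos_of_mul_pos_left h1 (hB.pos _ hx).le
  · rw [← (hh i x).1 hx, hu]
    split_ifs with hij
    · rfl
    · rw [← (hh j y).1 hy, hP.inner_apply_apply_of_ne hB hij, mul_zero]

lemma hasDerivAt_bilinForm_apply {E : Type*} [NormedAddCommGroup E] [NormedSpace ℝ E]
    [FiniteDimensional ℝ E] (q : E →ₗ[ℝ] E →ₗ[ℝ] ℝ) {f g : ℝ → E} {f' g' : E} {t : ℝ}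
    (hf : HasDerivAt f f' t) (hg : HasDerivAt g g' t) :
    HasDerivAt (fun s => q (f s) (g s)) (q f' (g t) + q (f t) g') t := by
  have := q.toContinuousBilinearMap.hasFDerivAt_of_bilinear hf.hasFDerivAt hg.hasFDerivAt
  simpa [add_comm] using this.hasDerivAt

variable {n : ℕ} {G : Type*} [TopologicalSpace G] [ChartedSpace (EuclideanSpace ℝ (Fin n)) G]
  [Group G]

variable [LieGroup (𝓡 n) (minSmoothness ℝ 3) G]

/-- The infinitesimal form of the invariance of an inner product under a subgroup. -/
lemma HasLieAlgebra.apply_lie_eq_neg {H : Subgroup G}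
    {s : Submodule ℝ (GroupLieAlgebra (𝓡 n) G)} (hH : HasLieAlgebra H s)
    {q : LinearMap.BilinForm ℝ (GroupLieAlgebra (𝓡 n) G)} (hq : IsAdInvariant H q)
    {x : GroupLieAlgebra (𝓡 n) G} (hx : x ∈ s) (y z : GroupLieAlgebra (𝓡 n) G) :
    q ⁅x, y⁆ z = -q y ⁅x, z⁆ := by
  obtain ⟨γ, hγ, hγ0, hγH, hγx⟩ := (hH x).1 hx
  have h1 := hasDerivAt_bilinForm_apply (E := EuclideanSpace ℝ (Fin n)) q
    (hasDerivAt_groupAd_curve hγ hγ0 hγx y) (hasDerivAt_groupAd_curve hγ hγ0 hγx z)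
  have h2 : HasDerivAt (fun t => q (groupAd (γ t) y) (groupAd (γ t) z)) 0 0 := by
    simp only [fun t => hq _ (hγH t) y z]
    exact hasDerivAt_const 0 _
  have h3 := h1.unique h2
  have h4 : ∀ w : GroupLieAlgebra (𝓡 n) G, groupAd (γ 0) w = w := fun w => by
    rw [hγ0, groupAd_one]
  have h5 : q ⁅x, y⁆ (groupAd (γ 0) z) + q (groupAd (γ 0) y) ⁅x, z⁆ = 0 := h3
  rw [h4, h4] at h5
  linarith

lemma IsLeviCivita.isEinstein_iff {q : LinearMap.BilinForm ℝ (GroupLieAlgebra (𝓡 n) G)}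
    {nabla : CovariantDerivative (𝓡 n) (EuclideanSpace ℝ (Fin n))
      (TangentSpace (𝓡 n) : G → Type _)} (hn : IsLeviCivita (leftInvariantMetric q) nabla)
    (hq : IsInnerProduct q)
    {U : GroupLieAlgebra (𝓡 n) G →ₗ[ℝ] GroupLieAlgebra (𝓡 n) G →ₗ[ℝ] GroupLieAlgebra (𝓡 n) G}
    (hU : IsKoszulProduct q U) :
    IsEinstein (leftInvariantMetric q) nabla ↔ ∃ c : ℝ, ∀ x y, ricciForm U x y = c * q x y := by
  simp only [IsEinstein, hn.ricci_mulInvariantVectorField hq hU,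
    leftInvariantMetric_mulInvariantVectorField, ricciForm_apply]
  exact exists_congr fun c => ⟨fun h x y => h x y 1, fun h x y _ => h x y⟩

end InvariantMetrics
end EinsteinF4

theorem proposition5p2
    {n : ℕ} {G : Type*} [TopologicalSpace G] [ChartedSpace (EuclideanSpace ℝ (Fin n)) G] [Group G]
    [LieGroup (𝓡 n) (minSmoothness ℝ 3) G] [CompactSpace G]
    [LieAlgebra.IsKilling ℝ (GroupLieAlgebra (𝓡 n) G)]
    -- the fundamental system `α₁, …, α₄` of type `F₄`
    (S : EinsteinF4.FundamentalSystemF4 (GroupLieAlgebra (𝓡 n) G))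
    -- `θ = e^{ad T}` with `α₄(T) = π√-1` and `αⱼ(T) = 0` for `j ≠ 4`
    (T : S.t)
    (hT₁ : S.simpleRoot 0 T = 0) (hT₂ : S.simpleRoot 1 T = 0) (hT₃ : S.simpleRoot 2 T = 0)
    (hT₄ : S.simpleRoot 3 T = Real.pi * Complex.I)
    (θ : Module.End ℝ (GroupLieAlgebra (𝓡 n) G)) (hθ : θ = EinsteinF4.expAd (T : GroupLieAlgebra (𝓡 n) G))
    -- `τ = e^{ad T'}` with `α₃(T') = π√-1` and `α₁(T') = α₂(T') = φ(T') = 0`,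
    -- where `φ = 2α₁ + 3α₂ + 4α₃ + 2α₄` is the highest root
    (T' : S.t)
    (hT'₁ : S.simpleRoot 0 T' = 0) (hT'₂ : S.simpleRoot 1 T' = 0)
    (hT'₃ : S.simpleRoot 2 T' = Real.pi * Complex.I)
    (hT'φ : 2 * S.simpleRoot 0 T' + 3 * S.simpleRoot 1 T' + 4 * S.simpleRoot 2 T'
      + 2 * S.simpleRoot 3 T' = 0)
    (τ : Module.End ℝ (GroupLieAlgebra (𝓡 n) G)) (hτ : τ = EinsteinF4.expAd (T' : GroupLieAlgebra (𝓡 n) G))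
    -- the subspaces `𝔥₁, 𝔥₂, 𝔥₃, 𝔥₄`
    (h : Fin 4 → Submodule ℝ (GroupLieAlgebra (𝓡 n) G))
    (hh : h = EinsteinF4.jointEigenspace θ τ)
    (B : LinearMap.BilinForm ℝ (GroupLieAlgebra (𝓡 n) G))
    (hB : EinsteinF4.IsAssociativeInnerProduct B) :
    DirectSum.IsInternal h ∧
    -- every `Ad(H₁)`-invariant left-invariant metric has the stated form
    (∀ H₁ : Subgroup G, EinsteinF4.HasLieAlgebra H₁ (h 0) →
      ∀ q : LinearMap.BilinForm ℝ (GroupLieAlgebra (𝓡 n) G),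
        EinsteinF4.IsInnerProduct q → EinsteinF4.IsAdInvariant H₁ q →
          ∃ u : Fin 4 → ℝ, (∀ i, 0 < u i) ∧ EinsteinF4.IsBlockSum h B u q) ∧
    -- the Einstein equations
    (∀ u₁ u₂ u₃ u₄ : ℝ, 0 < u₁ → 0 < u₂ → 0 < u₃ → 0 < u₄ →
      ∀ q : LinearMap.BilinForm ℝ (GroupLieAlgebra (𝓡 n) G),
        EinsteinF4.IsBlockSum h B ![u₁, u₂, u₃, u₄] q →
      ∀ nabla : CovariantDerivative (𝓡 n) (EuclideanSpace ℝ (Fin n))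
          (TangentSpace (𝓡 n) : G → Type _),
        EinsteinF4.IsLeviCivita (EinsteinF4.leftInvariantMetric q) nabla →
      (EinsteinF4.IsEinstein (EinsteinF4.leftInvariantMetric q) nabla ↔
        (-(3 / u₁) - u₁ / (2 * u₂ ^ 2) - u₁ / (2 * u₃ ^ 2) - u₁ / (2 * u₄ ^ 2)
            = 7 * u₁ / (2 * u₂ ^ 2) - 9 / u₂
              + (u₃ ^ 2 + u₄ ^ 2 - u₂ ^ 2) / (u₂ * u₃ * u₄) ∧
          7 * u₁ / (2 * u₂ ^ 2) - 9 / u₂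
              + (u₃ ^ 2 + u₄ ^ 2 - u₂ ^ 2) / (u₂ * u₃ * u₄)
            = 7 * u₁ / (2 * u₃ ^ 2) - 9 / u₃
              + (u₂ ^ 2 + u₄ ^ 2 - u₃ ^ 2) / (u₂ * u₃ * u₄) ∧
          7 * u₁ / (2 * u₃ ^ 2) - 9 / u₃
              + (u₂ ^ 2 + u₄ ^ 2 - u₃ ^ 2) / (u₂ * u₃ * u₄)
            = 7 * u₁ / (2 * u₄ ^ 2) - 9 / u₄
              + (u₂ ^ 2 + u₃ ^ 2 - u₄ ^ 2) / (u₂ * u₃ * u₄)))) := by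
  subst hθ hτ hh
  have hsign := S.isSignPair_expAd hT₁ hT₂ hT₃ hT₄ hT'₁ hT'₂ hT'₃ hT'φ
  have hP := hsign.isSpinGrading hT₁ hT₂ hT₃ hT₄
  have hmem := hsign.mem_jointEigenspace_iff
  set P := EinsteinF4.kleinProj (EinsteinF4.expAd (T : GroupLieAlgebra (𝓡 n) G))
    (EinsteinF4.expAd (T' : GroupLieAlgebra (𝓡 n) G))
  refine ⟨hP.isInternal hmem, fun H₁ hH q hq hqH => ?_, ?_⟩
  · refine hP.exists_isBlockSum hB hmem hq fun x y z => ?_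
    exact hH.apply_lie_eq_neg hqH ((hmem 0 _).2 (hP.apply_self 0 x)) y z
  · intro u₁ u₂ u₃ u₄ h₁ h₂ h₃ h₄ q hblock nabla hn
    have hu : ∀ i, 0 < ![u₁, u₂, u₃, u₄] i := by
      intro i; fin_cases i <;> assumption
    have hq := hblock.isInnerProduct hP hB hmem hu
    have hU := hP.isKoszulProduct_block hB hmem hu hblock
    obtain ⟨a, ha, l, hl, h00, h0, hi⟩ := hP.exists_partialKilling_table hB
    rw [hn.isEinstein_iff hq hU, hP.exists_ricciForm_eq_iff hB hmem hblock hl,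
      EinsteinF4.exists_ricciCoeff_eq_iff ha h00 h0 hi h₁ h₂ h₃ h₄]
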